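/- **Conventions.** Fix a (possibly multi-sorted) signature; structures may be empty. A *formula* is a positive first-order formula, i.e. one built from atomic formulas (including equalities) with $\top,\bot,\wedge,\vee,\exists$. A *positive theory* $T$ is a set of sentences of the form $\forall x(\varphi(x)\to\psi(x))$ with $\varphi,\psi$ formulas. A model $M$ of $T$ is *p.c.* (positively closed) if every homomorphism $f\colon M\to N$ into a model $N$ of $T$ is an immersion, i.e. $M\models\varphi(a)\Leftrightarrow N\models\varphi(f(a))$ for all formulas $\varphi$ and tuples $a$ in $M$. We write $|T|$ for the number of formulas $\varphi(x)$, $x$ a finite tuple of variables, up to equivalence modulo $T$. Parameters are taken from p.c. models, and further tuples from p.c. continuations, i.e. p.c. models $N$ with a homomorphism $f\colon M\to N$ (when $T$ has the joint continuation property all of this may be thought of as taking place in one monster model). For $B$ a set of elements of a p.c. model $M$ and an index set $I$ (with a sort for each $i \in I$), an *$I$-type over $B$* is a set of the form $\operatorname{tp}(a/B)=\{\varphi(x,b): b\in B,\ N\models\varphi(a,f(b))\}$ with $a$ an $I$-tuple in a p.c. continuation $f\colon M\to N$; $S_I(B)$ is the set of these. A set of formulas $\Sigma(x)$ over $M$ is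 *consistent* if it is realised in some p.c. continuation of $M$. * For an infinite cardinal $\lambda$, $T$ is *$\lambda$-stable* if $|S_I(B)|\le\lambda$ for all parameter sets $B$ with $|B|\le\lambda$ and all finite $I$; $T$ is *stable* if it is $\lambda$-stable for some infinite $\lambda$. * Formulas $\varphi(x,y),\psi(x,y)$ ($x,y$ finite tuples) are *contradictory* if $T\models\neg\exists x\,y\,(\varphi\wedge\psi)$. For such formulas the rank $R_{\varphi,\psi}$ is the least function from sets of formulas $\Sigma(x)$ with parameters in p.c. models to the ordinals together with $-1$ and $\infty$ such that: $R(\Sigma)\ge 0$ if $\Sigma$ is consistent; $R(\Sigma)\ge\alpha+1$ if there is a tuple $b$ (in some p.c. continuation) with $R(\Sigma\cup\{\varphi(x,b)\})\ge\alpha$ and $R(\Sigma\cup\{\psi(x,b)\})\ge\alpha$; and $R(\Sigma)\ge\ell$ if $R(\Sigma)\ge\alpha$ for all $\alpha<\ell$, for $\ell$ a limit ordinal. * A type $p(x)$ over $B\subseteq M$ (in any number of variables) is *definable* if for every formula $\varphi(x,y)$ without parameters, $y$ a finite tuple, there is a set $d_p\varphi(y)$ of formulas over $B$ with $|d_p\varphi(y)|\le|T|$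 such that for all $b\in B$: $\varphi(x,b)\in p(x)$ if and only if $M\models d_p\varphi(b)$. **Theorem.** The following are equivalent for a positive theory $T$: 1. $T$ is stable; 2. $R_{\varphi,\psi}(x=x)<\omega$ for all contradictory formulas $\varphi(x,y)$ and $\psi(x,y)$ (computed over any p.c. model of $T$); 3. every type, over every parameter set, is definable; 4. $T$ is $\lambda$-stable for every infinite cardinal $\lambda$ with $\lambda^{|T|}=\lambda$. -/

import Mathlib

open Cardinal

universe u v w

namespace PositiveLogic

/-- A multi-sorted signature. Constant symbols are function symbols of arity `0`. -/
structure Signature where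
  Sorts : Type u
  Fn : Type u
  fnArity : Fn → ℕ
  fnDom : (f : Fn) → Fin (fnArity f) → Sorts
  fnCod : Fn → Sorts
  Rel : Type u
  relArity : Rel → ℕ
  relDom : (R : Rel) → Fin (relArity R) → Sorts

/-- Terms, sorted, in variables indexed by `V`, where the variable `x` has sort `Γ x`. -/
inductive Term (L : Signature.{u}) {V : Type v} (Γ : V → L.Sorts) : L.Sorts → Type (max u v)
  | var (x : V) : Term L Γ (Γ x)
  | app (f : L.Fn) (ts : (i : Fin (L.fnArity f)) → Term L Γ (L.fnDom f i)) : Term L Γ (L.fnCod f)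

/-- Positive formulas whose free variables are indexed by `V` (with sorts `Γ`) and by `Fin n`
(with sorts `Δ`). The variables in `Fin n` are those that are to be bound by quantifiers: `ex s`
quantifies over the variable `0`, of sort `s`, and the other ones are shifted. -/
inductive BFormula (L : Signature.{u}) {V : Type v} (Γ : V → L.Sorts) :
    (n : ℕ) → (Fin n → L.Sorts) → Type (max u v)
  | top {n : ℕ} {Δ : Fin n → L.Sorts} : BFormula L Γ n Δ
  | bot {n : ℕ} {Δ : Fin n → L.Sorts} : BFormula L Γ n Δ
  | eq {n : ℕ} {Δ : Fin n → L.Sorts} {s : L.Sorts} (t₁ t₂ : Term L (Sum.elim Γ Δ) s) :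
      BFormula L Γ n Δ
  | rel {n : ℕ} {Δ : Fin n → L.Sorts} (R : L.Rel)
      (ts : (i : Fin (L.relArity R)) → Term L (Sum.elim Γ Δ) (L.relDom R i)) : BFormula L Γ n Δ
  | and {n : ℕ} {Δ : Fin n → L.Sorts} (φ ψ : BFormula L Γ n Δ) : BFormula L Γ n Δ
  | or {n : ℕ} {Δ : Fin n → L.Sorts} (φ ψ : BFormula L Γ n Δ) : BFormula L Γ n Δ
  | ex {n : ℕ} {Δ : Fin n → L.Sorts} (s : L.Sorts)
      (φ : BFormula L Γ (n + 1) (Fin.cons (α := fun _ => L.Sorts) s Δ)) : BFormula L Γ n Δ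

/-- Positive formulas with free variables indexed by `V`, the variable `x` having sort `Γ x`. -/
abbrev Formula (L : Signature.{u}) {V : Type v} (Γ : V → L.Sorts) : Type (max u v) :=
  BFormula L Γ 0 Fin.elim0

/-- Structures; any of the sorts (or all of them) may be empty. -/
structure Str (L : Signature.{u}) where
  carrier : L.Sorts → Type u
  fn : (f : L.Fn) → ((i : Fin (L.fnArity f)) → carrier (L.fnDom f i)) → carrier (L.fnCod f)
  rel : (R : L.Rel) → ((i : Fin (L.relArity R)) → carrier (L.relDom R i)) → Prop

variable {L : Signature.{u}}

/-- The tuple `a` followed by the tuple `b`. -/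
def Str.join (M : Str L) {V : Type v} {W : Type w} {Γ : V → L.Sorts} {Δ : W → L.Sorts}
    (a : (x : V) → M.carrier (Γ x)) (b : (y : W) → M.carrier (Δ y)) :
    (z : V ⊕ W) → M.carrier (Sum.elim Γ Δ z)
  | Sum.inl x => a x
  | Sum.inr y => b y

/-- The tuple `b` with the element `m` put in front of it. -/
def Str.cons (M : Str L) {n : ℕ} {Δ : Fin n → L.Sorts} {s : L.Sorts} (m : M.carrier s)
    (b : (i : Fin n) → M.carrier (Δ i)) :
    (i : Fin (n + 1)) → M.carrier (Fin.cons (α := fun _ => L.Sorts) s Δ i) :=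
  Fin.cons (α := fun i => M.carrier (Fin.cons (α := fun _ => L.Sorts) s Δ i)) m b

def Term.eval (M : Str L) {V : Type v} {Γ : V → L.Sorts} (a : (x : V) → M.carrier (Γ x)) :
    {s : L.Sorts} → Term L Γ s → M.carrier s
  | _, .var x => a x
  | _, .app f ts => M.fn f (fun i => (ts i).eval M a)

def BFormula.Realize (M : Str L) {V : Type v} {Γ : V → L.Sorts} (a : (x : V) → M.carrier (Γ x)) :
    {n : ℕ} → {Δ : Fin n → L.Sorts} → BFormula L Γ n Δ → ((i : Fin n) → M.carrier (Δ i)) → Prop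
  | _, _, .top, _ => True
  | _, _, .bot, _ => False
  | _, _, .eq t₁ t₂, b => t₁.eval M (M.join a b) = t₂.eval M (M.join a b)
  | _, _, .rel R ts, b => M.rel R (fun i => (ts i).eval M (M.join a b))
  | _, _, .and φ ψ, b => φ.Realize M a b ∧ ψ.Realize M a b
  | _, _, .or φ ψ, b => φ.Realize M a b ∨ ψ.Realize M a b
  | _, _, .ex s φ, b => ∃ m : M.carrier s, φ.Realize M a (M.cons m b)

/-- `M.Sat φ a` means `M ⊨ φ(a)`. -/
def Str.Sat (M : Str L) {V : Type v} {Γ : V → L.Sorts} (φ : Formula L Γ)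
    (a : (x : V) → M.carrier (Γ x)) : Prop :=
  BFormula.Realize M a φ (fun i => i.elim0)

/-- Homomorphisms of structures. -/
structure Hom (M N : Str L) where
  toFun : {s : L.Sorts} → M.carrier s → N.carrier s
  map_fn : ∀ (f : L.Fn) (a : (i : Fin (L.fnArity f)) → M.carrier (L.fnDom f i)),
    toFun (M.fn f a) = N.fn f (fun i => toFun (a i))
  map_rel : ∀ (R : L.Rel) (a : (i : Fin (L.relArity R)) → M.carrier (L.relDom R i)),
    M.rel R a → N.rel R (fun i => toFun (a i))

/-- The image of a tuple under a homomorphism. -/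
def Hom.tuple {M N : Str L} (f : Hom M N) {V : Type v} {Γ : V → L.Sorts}
    (a : (x : V) → M.carrier (Γ x)) : (x : V) → N.carrier (Γ x) :=
  fun x => f.toFun (a x)

/-- Immersions: homomorphisms that preserve and reflect the truth of positive formulas. -/
def Hom.IsImmersion {M N : Str L} (f : Hom M N) : Prop :=
  ∀ (n : ℕ) (Γ : Fin n → L.Sorts) (φ : Formula L Γ) (a : (i : Fin n) → M.carrier (Γ i)),
    M.Sat φ a ↔ N.Sat φ (f.tuple a)

/-- An h-inductive sentence `∀ x (φ(x) → ψ(x))`, where `φ` and `ψ` are positive formulas. -/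
structure HInductive (L : Signature.{u}) where
  n : ℕ
  Γ : Fin n → L.Sorts
  φ : Formula L Γ
  ψ : Formula L Γ

/-- A positive theory is a set of h-inductive sentences. -/
abbrev Theory (L : Signature.{u}) : Type u := Set (HInductive L)

namespace Theory

variable (T : Theory L)

def IsModel (M : Str L) : Prop :=
  ∀ χ ∈ T, ∀ a : (i : Fin χ.n) → M.carrier (χ.Γ i), M.Sat χ.φ a → M.Sat χ.ψ a

/-- Positively closed models: every homomorphism into a model of `T` is an immersion. -/
def IsPC (M : Str L) : Prop :=
  T.IsModel M ∧ ∀ N : Str L, T.IsModel N → ∀ f : Hom M N, f.IsImmersion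

/-- `φ` and `ψ` are equivalent modulo `T`. -/
def equivSetoid {n : ℕ} (Γ : Fin n → L.Sorts) : Setoid (Formula L Γ) where
  r φ ψ := ∀ M : Str L, T.IsModel M → ∀ a : (i : Fin n) → M.carrier (Γ i), M.Sat φ a ↔ M.Sat ψ a
  iseqv :=
    ⟨fun _ _ _ _ => Iff.rfl, fun h M hM a => (h M hM a).symm,
      fun h h' M hM a => (h M hM a).trans (h' M hM a)⟩

/-- `|T|`: the number of formulas `φ(x)`, with `x` a finite tuple of variables, up to equivalence
modulo `T`. -/
noncomputable def card : Cardinal.{u} :=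
  #(Σ n : ℕ, Σ Γ : Fin n → L.Sorts, Quotient (T.equivSetoid Γ))

/-- `φ` and `ψ` are contradictory modulo `T`, i.e. `T ⊨ ¬ ∃ x (φ(x) ∧ ψ(x))`. -/
def Contradictory {V : Type v} {Γ : V → L.Sorts} (φ ψ : Formula L Γ) : Prop :=
  ∀ M : Str L, T.IsModel M → ∀ a : (x : V) → M.carrier (Γ x), ¬ (M.Sat φ a ∧ M.Sat ψ a)

end Theory

/-- Formulas with parameters in `M`: `φ(x, b)` where `φ(x, y)` has no parameters, `y` is a finite
tuple of variables and `b` is a matching tuple in `M`. The variables `x` are indexed by `I`. -/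
structure PFormula (M : Str L) {I : Type w} (σ : I → L.Sorts) where
  n : ℕ
  τ : Fin n → L.Sorts
  φ : Formula L (Sum.elim σ τ)
  b : (j : Fin n) → M.carrier (τ j)

namespace PFormula

variable {M N : Str L} {I : Type w} {σ : I → L.Sorts}

/-- The parameters of `p` are in `B`. -/
def Over (p : PFormula M σ) (B : Set (Σ s, M.carrier s)) : Prop :=
  ∀ j, ⟨p.τ j, p.b j⟩ ∈ B

/-- `M ⊨ φ(a, b)` -/
def Sat (p : PFormula M σ) (a : (i : I) → M.carrier (σ i)) : Prop :=
  M.Sat p.φ (M.join a p.b)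

/-- The formula `φ(x, f(b))` over `N` for a homomorphism `f : M → N`. -/
def map (f : Hom M N) (p : PFormula M σ) : PFormula N σ :=
  ⟨p.n, p.τ, p.φ, f.tuple p.b⟩

end PFormula

/-- The set of formulas `x = x`, i.e. `{xᵢ = xᵢ : i ∈ I}`, over `M`. -/
def selfEq (M : Str L) {I : Type w} (σ : I → L.Sorts) : Set (PFormula M σ) :=
  Set.range fun i : I =>
    ⟨0, Fin.elim0, .eq (.var (Sum.inl (Sum.inl i))) (.var (Sum.inl (Sum.inl i))), fun j => j.elim0⟩

namespace Theory

variable (T : Theory L)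

/-! Everything that the monster model would contain is taken from arbitrary p.c. models here:
parameters come from some p.c. model `M`, and further tuples from p.c. models `N` that continue
`M`, i.e. that come with a homomorphism `f : M → N` (necessarily an immersion). -/

/-- `S_I(B)` for a subset `B` of the p.c. model `M`: the set of all `tp(a/B)`, where `a` is a tuple
with index set `I` (and sorts `σ`) in a p.c. model that continues `M`. -/
def typeSpace (M : Str L) (B : Set (Σ s, M.carrier s)) {I : Type w} (σ : I → L.Sorts) :
    Set (Set (PFormula M σ)) :=
  {p | ∃ N : Str L, T.IsPC N ∧ ∃ (f : Hom M N) (a : (i : I) → N.carrier (σ i)),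
    p = {q | q.Over B ∧ (q.map f).Sat a}}

/-- `T` is `lam`-stable. -/
def IsLambdaStable (lam : Cardinal.{u}) : Prop :=
  ℵ₀ ≤ lam ∧ ∀ M : Str L, T.IsPC M → ∀ B : Set (Σ s, M.carrier s), #B ≤ lam →
    ∀ (I : Type u) [Finite I] (σ : I → L.Sorts), #(T.typeSpace M B σ) ≤ lam

def IsStable : Prop := ∃ lam : Cardinal.{u}, T.IsLambdaStable lam

/-- The type `p(x)` over `B` is definable over `C`: for every formula `φ(x, y)` there is a set `D`
of formulas `d(y)` over `C` with `|D| ≤ |T|` such that, for all `b` in `B`, we have `φ(x, b) ∈ p`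
if and only if `b` satisfies all formulas in `D`. -/
def IsDefinableOver {M : Str L} {I : Type w} {σ : I → L.Sorts} (p : Set (PFormula M σ))
    (B C : Set (Σ s, M.carrier s)) : Prop :=
  ∀ (n : ℕ) (τ : Fin n → L.Sorts) (φ : Formula L (Sum.elim σ τ)),
    ∃ D : Set (PFormula M τ), (∀ d ∈ D, d.Over C) ∧ #D ≤ T.card ∧
      ∀ b : (j : Fin n) → M.carrier (τ j), (∀ j, ⟨τ j, b j⟩ ∈ B) →
        ((⟨n, τ, φ, b⟩ : PFormula M σ) ∈ p ↔ ∀ d ∈ D, d.Sat b)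

/-- A set of formulas over the p.c. model `M` is consistent. -/
def Consistent (M : Str L) {I : Type w} {σ : I → L.Sorts} (S : Set (PFormula M σ)) : Prop :=
  ∃ N : Str L, T.IsPC N ∧ ∃ (f : Hom M N) (a : (i : I) → N.carrier (σ i)),
    ∀ q ∈ S, (q.map f).Sat a

/-- `T.RankGE φ ψ α M S` means that the `(φ, ψ)`-rank of the set `S` of formulas over the
p.c. model `M` is at least `α`. -/
inductive RankGE {I : Type u} {σ : I → L.Sorts} {n : ℕ} {τ : Fin n → L.Sorts}
    (φ ψ : Formula L (Sum.elim σ τ)) :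
    Ordinal.{u} → (M : Str L) → Set (PFormula M σ) → Prop
  | zero (M : Str L) (S : Set (PFormula M σ)) : T.Consistent M S → RankGE φ ψ 0 M S
  | succ (α : Ordinal.{u}) (M : Str L) (S : Set (PFormula M σ)) (N : Str L) (hN : T.IsPC N)
      (f : Hom M N) (b : (j : Fin n) → N.carrier (τ j)) :
      RankGE φ ψ α N (PFormula.map f '' S ∪ {⟨n, τ, φ, b⟩}) →
      RankGE φ ψ α N (PFormula.map f '' S ∪ {⟨n, τ, ψ, b⟩}) →
      RankGE φ ψ (Order.succ α) M S
  | limit (l : Ordinal.{u}) (M : Str L) (S : Set (PFormula M σ)) : Order.IsSuccLimit l →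
      (∀ α < l, RankGE φ ψ α M S) → RankGE φ ψ l M S

/-- The `(φ, ψ)`-rank of the set `S` of formulas over the p.c. model `M`, with values in the
ordinals extended by `⊥` (in the role of `-1`) and `⊤` (in the role of `∞`). -/
noncomputable def rank {I : Type u} {σ : I → L.Sorts} {n : ℕ} {τ : Fin n → L.Sorts}
    (φ ψ : Formula L (Sum.elim σ τ)) (M : Str L) (S : Set (PFormula M σ)) :
    WithBot (WithTop Ordinal.{u}) :=
  sSup {r | ∃ α : Ordinal.{u}, T.RankGE φ ψ α M S ∧ 
    r = ((α : WithTop Ordinal.{u}) : WithBot (WithTop Ordinal.{u}))}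

end Theory

end PositiveLogic

/-!
The equivalence is proved in the circle: stable ⇒ finite ranks ⇒ definable types ⇒ `λ`-stable
whenever `λ ^ |T| = λ` ⇒ stable.

*Ranks.* That `R_{φ,ψ}(Σ) ≥ k`, for a natural number `k`, means that there is a binary tree of
height `k` of instances of `φ` (to one side) and `ψ` (to the other side) with all branches
consistent with `Σ`. For a single formula `θ(x, z)` in place of `Σ`, the existence of such a tree is
expressed by a positive formula in `z` (`PosDef.hasTree`). Homomorphisms from p.c. models are
immersions, so the tree can be looked for in the p.c. model at hand, and the continuations in the
definition of the rank play no role: this is `RankGE.hasTree` and `rankGE_of_hasTree`, which give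
`rank_selfEq_lt_omega0_iff`.

*Stable implies finite ranks.* If there are trees of all finite heights, there are trees of any
height `μ` by compactness (`exists_tree`). For the least `μ` with `λ < 2 ^ μ`, such a tree has at
most `λ` nodes and more than `λ` branches, so that `T` is not `λ`-stable (`not_isLambdaStable`).

*Finite ranks imply definability.* In a p.c. model, a tuple that does not satisfy `φ` satisfies
some `ψ` that contradicts `φ` (`IsPC.exists_contradictory`). For every such `ψ`, one formula
`d_ψ(y)` about the rank `R_{φ,ψ}` holds of all `b` with `φ(x, b)` in the type and of no `b` with
`ψ(x, b)` in the type (`exists_separating_formula`). The set of all `d_ψ` therefore defines the type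
for `φ`, and it has at most `|T|` elements as `ψ` matters only up to equivalence
(`exists_definition`).

*Definability implies stability.* A definable type over `B` is determined by its definitions, hence
by a function from formulas to sets of at most `|T|` solution sets of formulas over `B`. If
`|B| ≤ λ` then there are at most `(λ ^ |T|) ^ |T|` of these (`mk_typeSpace_le`).

The model theory this rests on is developed first: ultraproducts, in the version for sorts that may
be empty, with Łoś's theorem and the compactness theorem (`compactness`), and the existence of p.c.
continuations (`exists_isPC`) as direct limits of chains in which all formulas that can be made true
of the elements of one stage are true at the next.
-/

namespace PositiveLogic

variable {L : Signature.{u}}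

/-! ### Homomorphisms -/

namespace Hom

/-- The identity homomorphism. -/
def id (M : Str L) : Hom M M where
  toFun x := x
  map_fn _ _ := rfl
  map_rel _ _ h := h

/-- Composition of homomorphisms: `f` followed by `g`. -/
def comp {M N K : Str L} (g : Hom N K) (f : Hom M N) : Hom M K where
  toFun x := g.toFun (f.toFun x)
  map_fn F a := by rw [f.map_fn, g.map_fn]
  map_rel R a h := g.map_rel R _ (f.map_rel R a h)

variable {M N : Str L} (f : Hom M N)

theorem tuple_join {V : Type v} {W : Type w} {Γ : V → L.Sorts} {Δ : W → L.Sorts}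
    (a : (x : V) → M.carrier (Γ x)) (b : (y : W) → M.carrier (Δ y)) :
    f.tuple (M.join a b) = N.join (f.tuple a) (f.tuple b) := by
  funext z
  cases z <;> rfl

theorem tuple_cons {n : ℕ} {Δ : Fin n → L.Sorts} {s : L.Sorts} (m : M.carrier s)
    (b : (i : Fin n) → M.carrier (Δ i)) :
    f.tuple (M.cons m b) = N.cons (f.toFun m) (f.tuple b) := by
  funext i
  refine Fin.cases ?_ (fun i => ?_) i <;> rfl

theorem eval_tuple {V : Type v} {Γ : V → L.Sorts} (a : (x : V) → M.carrier (Γ x)) {s : L.Sorts}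
    (t : Term L Γ s) : t.eval N (f.tuple a) = f.toFun (t.eval M a) := by
  induction t with
  | var x => rfl
  | app F ts ih => simp only [Term.eval, ih, f.map_fn]

theorem realize_tuple {V : Type v} {Γ : V → L.Sorts} (a : (x : V) → M.carrier (Γ x)) {n : ℕ}
    {Δ : Fin n → L.Sorts} (φ : BFormula L Γ n Δ) (b : (i : Fin n) → M.carrier (Δ i))
    (h : φ.Realize M a b) : φ.Realize N (f.tuple a) (f.tuple b) := by
  induction φ with
  | top => trivial
  | bot => exact h
  | eq t₁ t₂ =>
    simp only [BFormula.Realize, ← tuple_join, eval_tuple] at h ⊢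
    rw [h]
  | rel R ts =>
    simp only [BFormula.Realize, ← tuple_join, eval_tuple] at h ⊢
    exact f.map_rel R _ h
  | and φ ψ ih₁ ih₂ => exact ⟨ih₁ b h.1, ih₂ b h.2⟩
  | or φ ψ ih₁ ih₂ => exact h.imp (ih₁ b) (ih₂ b)
  | ex s φ ih =>
    obtain ⟨m, hm⟩ := h
    exact ⟨f.toFun m, by simpa only [tuple_cons] using ih _ hm⟩

/-- Homomorphisms preserve positive formulas. -/
theorem sat_tuple {V : Type v} {Γ : V → L.Sorts} (a : (x : V) → M.carrier (Γ x))
    {φ : Formula L Γ} (h : M.Sat φ a) : N.Sat φ (f.tuple a) := by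
  have := f.realize_tuple a φ _ h
  rwa [Subsingleton.elim (f.tuple _) (fun i : Fin 0 => i.elim0)] at this

end Hom

/-! ### Substitution -/

/-- The variable `x` among the variables `x, y`. -/
def Term.inl {V : Type v} {W : Type w} {Γ : V → L.Sorts} {Δ : W → L.Sorts} (x : V) :
    Term L (Sum.elim Γ Δ) (Γ x) :=
  .var (Γ := Sum.elim Γ Δ) (Sum.inl x)

/-- The variable `y` among the variables `x, y`. -/
def Term.inr {V : Type v} {W : Type w} {Γ : V → L.Sorts} {Δ : W → L.Sorts} (y : W) :
    Term L (Sum.elim Γ Δ) (Δ y) :=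
  .var (Γ := Sum.elim Γ Δ) (Sum.inr y)

/-- Substitution of terms for variables in a term. -/
def Term.subst {V : Type v} {W : Type w} {Γ : V → L.Sorts} {Δ : W → L.Sorts}
    (t : (x : V) → Term L Δ (Γ x)) : {s : L.Sorts} → Term L Γ s → Term L Δ s
  | _, .var x => t x
  | _, .app f ts => .app f (fun i => (ts i).subst t)

theorem Term.eval_subst (M : Str L) {V : Type v} {W : Type w} {Γ : V → L.Sorts}
    {Δ : W → L.Sorts} (t : (x : V) → Term L Δ (Γ x)) (a : (y : W) → M.carrier (Δ y))
    {s : L.Sorts} (r : Term L Γ s) :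
    (r.subst t).eval M a = r.eval M (fun x => (t x).eval M a) := by
  induction r with
  | var x => rfl
  | app f ts ih => simp only [Term.subst, Term.eval, ih]

/-- The extension under a quantifier of a substitution for the free and bound variables. -/
def liftSubst {V : Type v} {W : Type w} {Γ : V → L.Sorts} {Γ' : W → L.Sorts} {n k : ℕ}
    {Δ : Fin n → L.Sorts} {Δ' : Fin k → L.Sorts} (s : L.Sorts)
    (t : (z : V ⊕ Fin n) → Term L (Sum.elim Γ' Δ') (Sum.elim Γ Δ z)) :
    (z : V ⊕ Fin (n + 1)) → Term L (Sum.elim Γ' (Fin.cons (α := fun _ => L.Sorts) s Δ'))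
      (Sum.elim Γ (Fin.cons (α := fun _ => L.Sorts) s Δ) z) :=
  let up : {s' : L.Sorts} → Term L (Sum.elim Γ' Δ') s' →
      Term L (Sum.elim Γ' (Fin.cons (α := fun _ => L.Sorts) s Δ')) s' :=
    Term.subst (fun
      | Sum.inl x => Term.inl x
      | Sum.inr i =>
        Term.inr (Δ := Fin.cons (α := fun _ => L.Sorts) s Δ') i.succ)
  fun
    | Sum.inl x => up (t (Sum.inl x))
    | Sum.inr i =>
      Fin.cases (motive := fun i => Term L (Sum.elim Γ' (Fin.cons (α := fun _ => L.Sorts) s Δ'))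
          (Fin.cons (α := fun _ => L.Sorts) s Δ i))
        (Term.inr (Δ := Fin.cons (α := fun _ => L.Sorts) s Δ') 0)
        (fun i => up (t (Sum.inr i))) i

theorem eval_liftSubst (M : Str L) {V : Type v} {W : Type w} {Γ : V → L.Sorts}
    {Γ' : W → L.Sorts} {n k : ℕ} {Δ : Fin n → L.Sorts} {Δ' : Fin k → L.Sorts} {s : L.Sorts}
    {t : (z : V ⊕ Fin n) → Term L (Sum.elim Γ' Δ') (Sum.elim Γ Δ z)}
    {a : (x : V) → M.carrier (Γ x)} {b : (i : Fin n) → M.carrier (Δ i)}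
    {a' : (x : W) → M.carrier (Γ' x)} {b' : (i : Fin k) → M.carrier (Δ' i)}
    (h : ∀ z, (t z).eval M (M.join a' b') = M.join a b z) (m : M.carrier s) (z : V ⊕ Fin (n + 1)) :
    (liftSubst s t z).eval M (M.join a' (M.cons m b')) = M.join a (M.cons m b) z := by
  have key : ∀ {s' : L.Sorts} (r : Term L (Sum.elim Γ' Δ') s'),
      (Term.subst (fun
        | Sum.inl x =>
          Term.inl x
        | Sum.inr i =>
          Term.inr (Δ := Fin.cons (α := fun _ => L.Sorts) s Δ') i.succ)
        r).eval M (M.join a' (M.cons m b')) = r.eval M (M.join a' b') := by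
    intro s' r
    rw [Term.eval_subst]
    congr 1
    funext y
    cases y <;> rfl
  rcases z with x | i
  · exact (key _).trans (h (Sum.inl x))
  · refine Fin.cases ?_ (fun i => ?_) i
    · rfl
    · exact (key _).trans (h (Sum.inr i))

/-- Substitution of terms for the free variables, and for the variables in `Fin n`, of a formula. -/
def BFormula.subst {V : Type v} {W : Type w} {Γ : V → L.Sorts} {Γ' : W → L.Sorts} :
    {n : ℕ} → {Δ : Fin n → L.Sorts} → BFormula L Γ n Δ → {k : ℕ} → {Δ' : Fin k → L.Sorts} →
    ((z : V ⊕ Fin n) → Term L (Sum.elim Γ' Δ') (Sum.elim Γ Δ z)) → BFormula L Γ' k Δ'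
  | _, _, .top, _, _, _ => .top
  | _, _, .bot, _, _, _ => .bot
  | _, _, .eq t₁ t₂, _, _, t => .eq (t₁.subst t) (t₂.subst t)
  | _, _, .rel R ts, _, _, t => .rel R (fun i => (ts i).subst t)
  | _, _, .and φ ψ, _, _, t => .and (φ.subst t) (ψ.subst t)
  | _, _, .or φ ψ, _, _, t => .or (φ.subst t) (ψ.subst t)
  | _, _, .ex s φ, _, _, t => .ex s (φ.subst (liftSubst s t))

theorem BFormula.realize_subst (M : Str L) {V : Type v} {W : Type w} {Γ : V → L.Sorts}
    {Γ' : W → L.Sorts} {n : ℕ} {Δ : Fin n → L.Sorts} (φ : BFormula L Γ n Δ) {k : ℕ}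
    {Δ' : Fin k → L.Sorts}
    {t : (z : V ⊕ Fin n) → Term L (Sum.elim Γ' Δ') (Sum.elim Γ Δ z)}
    {a : (x : V) → M.carrier (Γ x)} {b : (i : Fin n) → M.carrier (Δ i)}
    {a' : (x : W) → M.carrier (Γ' x)} {b' : (i : Fin k) → M.carrier (Δ' i)}
    (h : ∀ z, (t z).eval M (M.join a' b') = M.join a b z) :
    (φ.subst t).Realize M a' b' ↔ φ.Realize M a b := by
  induction φ generalizing k with
  | top => exact Iff.rfl
  | bot => exact Iff.rfl
  | eq t₁ t₂ => simp only [BFormula.subst, BFormula.Realize, Term.eval_subst, h]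
  | rel R ts => simp only [BFormula.subst, BFormula.Realize, Term.eval_subst, h]
  | and φ ψ ih₁ ih₂ => exact and_congr (ih₁ h) (ih₂ h)
  | or φ ψ ih₁ ih₂ => exact or_congr (ih₁ h) (ih₂ h)
  | ex s φ ih => exact exists_congr fun m => ih (eval_liftSubst M h m)

/-- The variable `x`, named by its image under the bijection `e`. -/
def Term.reindexVar {V : Type v} {W : Type w} (Γ : V → L.Sorts) (e : V ≃ W) (x : V) :
    Term L (fun y => Γ (e.symm y)) (Γ x) :=
  cast (congrArg (fun x => Term L (fun y => Γ (e.symm y)) (Γ x)) (e.symm_apply_apply x))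
    (Term.var (Γ := fun y => Γ (e.symm y)) (e x))

theorem Term.eval_reindexVar (M : Str L) {V : Type v} {W : Type w} {Γ : V → L.Sorts} (e : V ≃ W)
    (a : (x : V) → M.carrier (Γ x)) (x : V) :
    (Term.reindexVar Γ e x).eval M (fun y => a (e.symm y)) = a x := by
  have key : ∀ (x : V) (y : W) (h : e.symm y = x),
      (cast (congrArg (fun x => Term L (fun y => Γ (e.symm y)) (Γ x)) h)
        (Term.var (Γ := fun y => Γ (e.symm y)) y)).eval M (fun y => a (e.symm y)) = a x := by
    rintro x y rfl
    rfl
  exact key x (e x) (e.symm_apply_apply x)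

/-! ### Positively definable predicates -/

/-- A family of predicates on the tuples of sorts `Γ` in all structures is positively definable if
it is given by one positive formula. -/
def PosDef {V : Type v} (Γ : V → L.Sorts)
    (P : (M : Str L) → ((x : V) → M.carrier (Γ x)) → Prop) : Prop :=
  ∃ φ : Formula L Γ, ∀ M a, M.Sat φ a ↔ P M a

namespace PosDef

variable {V : Type v} {W : Type w} {Γ : V → L.Sorts} {Δ : W → L.Sorts}

theorem sat (φ : Formula L Γ) : PosDef Γ (fun M a => M.Sat φ a) := ⟨φ, fun _ _ => Iff.rfl⟩

theorem congr {P Q : (M : Str L) → ((x : V) → M.carrier (Γ x)) → Prop} (hP : PosDef Γ P)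
    (h : ∀ M a, P M a ↔ Q M a) : PosDef Γ Q := by
  obtain ⟨φ, hφ⟩ := hP
  exact ⟨φ, fun M a => (hφ M a).trans (h M a)⟩

theorem true : PosDef Γ (fun _ _ => True) := ⟨.top, fun _ _ => Iff.rfl⟩

theorem and {P Q : (M : Str L) → ((x : V) → M.carrier (Γ x)) → Prop} (hP : PosDef Γ P)
    (hQ : PosDef Γ Q) : PosDef Γ (fun M a => P M a ∧ Q M a) := by
  obtain ⟨φ, hφ⟩ := hP
  obtain ⟨ψ, hψ⟩ := hQ
  exact ⟨.and φ ψ, fun M a => and_congr (hφ M a) (hψ M a)⟩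

theorem all {J : Type*} (s : Finset J)
    {P : J → (M : Str L) → ((x : V) → M.carrier (Γ x)) → Prop} (hP : ∀ j ∈ s, PosDef Γ (P j)) :
    PosDef Γ (fun M a => ∀ j ∈ s, P j M a) := by
  classical
  induction s using Finset.induction_on with
  | empty => exact true.congr (by simp)
  | insert j s _ ih =>
    refine ((hP j (by simp)).and (ih fun i hi => hP i (by simp [hi]))).congr fun M a => ?_
    simp

/-- Terms may be substituted for the variables of a positively definable predicate. -/
theorem subst {P : (M : Str L) → ((x : V) → M.carrier (Γ x)) → Prop} (hP : PosDef Γ P)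
    (t : (x : V) → Term L Δ (Γ x)) :
    PosDef Δ (fun M a => P M (fun x => (t x).eval M a)) := by
  obtain ⟨φ, hφ⟩ := hP
  refine ⟨BFormula.subst φ (k := 0) (Δ' := Fin.elim0) (fun
    | Sum.inl x => (t x).subst
        (Term.inl (Δ := Fin.elim0))
    | Sum.inr i => i.elim0), fun M a => ?_⟩
  refine Iff.trans (BFormula.realize_subst M φ ?_) (hφ M fun x => (t x).eval M a)
  rintro (x | i)
  · exact Term.eval_subst M _ _ _
  · exact i.elim0

theorem eq {s : L.Sorts} (t₁ t₂ : Term L Γ s) :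
    PosDef Γ (fun M a => t₁.eval M a = t₂.eval M a) := by
  refine ⟨.eq (t₁.subst Term.inl) (t₂.subst Term.inl), fun M a => ?_⟩
  change (t₁.subst Term.inl).eval M _ = (t₂.subst Term.inl).eval M _ ↔ _
  rw [Term.eval_subst, Term.eval_subst]
  exact Iff.rfl

theorem rel (R : L.Rel) (ts : (i : Fin (L.relArity R)) → Term L Γ (L.relDom R i)) :
    PosDef Γ (fun M a => M.rel R (fun i => (ts i).eval M a)) := by
  refine ⟨.rel R fun i => (ts i).subst Term.inl, fun M a => ?_⟩
  change M.rel R (fun i => ((ts i).subst Term.inl).eval M _) ↔ _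
  simp only [Term.eval_subst]
  exact Iff.rfl

theorem exists_fin {n : ℕ} {E : Fin n → L.Sorts} (φ : BFormula L Γ n E) :
    PosDef Γ (fun M a => ∃ b, φ.Realize M a b) := by
  induction n with
  | zero =>
    obtain rfl : E = Fin.elim0 := Subsingleton.elim _ _
    refine ⟨φ, fun M a => ⟨fun h => ⟨_, h⟩, fun ⟨b, h⟩ => ?_⟩⟩
    rwa [Subsingleton.elim b (fun i : Fin 0 => i.elim0)] at h
  | succ n ih =>
    -- The sorts `E` have to be replaced by `Fin.cons (E 0) (Fin.tail E)` for `ex` to apply.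
    let Δ' : Fin (n + 1) → L.Sorts := Fin.cons (α := fun _ => L.Sorts) (E 0) (Fin.tail E)
    let t : (z : V ⊕ Fin (n + 1)) → Term L (Sum.elim Γ Δ') (Sum.elim Γ E z)
      | Sum.inl x => Term.inl x
      | Sum.inr i => Fin.cases (motive := fun i => Term L (Sum.elim Γ Δ') (E i))
          (Term.inr (Δ := Δ') 0) (fun i => Term.inr (Δ := Δ') i.succ) i
    refine (ih (E := Fin.tail E) (.ex (E 0) (φ.subst t))).congr fun M a => ?_
    have hb : ∀ b : (i : Fin (n + 1)) → M.carrier (E i),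
        BFormula.Realize M a (φ.subst t) (M.cons (b 0) (Fin.tail b)) ↔ φ.Realize M a b :=
      fun b => BFormula.realize_subst M φ (by
        rintro (x | i)
        · rfl
        · refine Fin.cases ?_ (fun i => ?_) i <;> rfl)
    constructor
    · rintro ⟨c, m, h⟩
      exact ⟨Fin.cons (α := fun i => M.carrier (E i)) m c, (hb _).1 h⟩
    · rintro ⟨b, h⟩
      exact ⟨Fin.tail b, b 0, (hb b).2 h⟩

/-- Quantification over a finite tuple of variables. -/
theorem exists_tuple [Finite W]
    {P : (M : Str L) → ((z : V ⊕ W) → M.carrier (Sum.elim Γ Δ z)) → Prop}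
    (hP : PosDef (Sum.elim Γ Δ) P) :
    PosDef Γ (fun M a => ∃ b : (y : W) → M.carrier (Δ y), P M (M.join a b)) := by
  obtain ⟨φ, hφ⟩ := hP
  obtain ⟨n, ⟨e⟩⟩ := Finite.exists_equiv_fin W
  let r : (z : (V ⊕ W) ⊕ Fin 0) → Term L (Sum.elim Γ (fun i => Δ (e.symm i)))
      (Sum.elim (Sum.elim Γ Δ) Fin.elim0 z)
    | Sum.inl (Sum.inl x) => Term.inl x
    | Sum.inl (Sum.inr w) => (Term.reindexVar Δ e w).subst (Term.inr (Δ := fun i => Δ (e.symm i)))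
    | Sum.inr i => i.elim0
  refine (exists_fin (φ.subst r)).congr fun M a => ?_
  have hb : ∀ b : (y : W) → M.carrier (Δ y),
      BFormula.Realize M a (φ.subst r) (fun i => b (e.symm i)) ↔ P M (M.join a b) := fun b => by
    rw [← hφ]
    refine BFormula.realize_subst M φ ?_
    rintro ((x | w) | i)
    · rfl
    · exact (Term.eval_subst M _ _ _).trans (Term.eval_reindexVar M e b w)
    · exact i.elim0
  constructor
  · rintro ⟨c, h⟩
    obtain ⟨b, rfl⟩ : ∃ b : (y : W) → M.carrier (Δ y), (fun i => b (e.symm i)) = c := by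
      have castElt : ∀ (w : W) (i : Fin n), e.symm i = w →
          ∃ m : M.carrier (Δ w), HEq m (c i) := by
        rintro w i rfl
        exact ⟨c i, HEq.rfl⟩
      choose b hb using fun w => castElt w (e w) (e.symm_apply_apply w)
      refine ⟨b, funext fun i => eq_of_heq ((hb _).trans ?_)⟩
      rw [e.apply_symm_apply]
    exact ⟨b, (hb b).1 h⟩
  · rintro ⟨b, h⟩
    exact ⟨_, (hb b).2 h⟩

end PosDef

/-! ### Renaming and finite supports of formulas -/

/-- The formula `φ`, with its variables renamed along the bijection `e`. -/
def Formula.reindex {V : Type v} {W : Type w} {Γ : V → L.Sorts} (e : V ≃ W) (φ : Formula L Γ) :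
    Formula L (fun y => Γ (e.symm y)) :=
  BFormula.subst φ (k := 0) (Δ' := Fin.elim0) (fun
    | Sum.inl x => (Term.reindexVar Γ e x).subst (Term.inl (Δ := Fin.elim0))
    | Sum.inr i => i.elim0)

theorem Formula.sat_reindex (M : Str L) {V : Type v} {W : Type w} {Γ : V → L.Sorts} (e : V ≃ W)
    (φ : Formula L Γ) (a : (x : V) → M.carrier (Γ x)) :
    M.Sat (φ.reindex e) (fun y => a (e.symm y)) ↔ M.Sat φ a := by
  refine BFormula.realize_subst M φ ?_
  rintro (x | i)
  · exact (Term.eval_subst M _ _ _).trans (Term.eval_reindexVar M e a x)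
  · exact i.elim0

theorem Term.exists_support {V : Type v} {W : Type w} {Γ : V → L.Sorts} {E : W → L.Sorts}
    {s : L.Sorts} (t : Term L (Sum.elim Γ E) s) :
    ∃ S : Set V, S.Finite ∧ ∀ S', S ⊆ S' →
      ∃ t' : Term L (Sum.elim (fun x : S' => Γ x) E) s, ∀ (M : Str L)
        (a : (x : V) → M.carrier (Γ x)) (b : (y : W) → M.carrier (E y)),
        t'.eval M (M.join (fun x : S' => a x) b) = t.eval M (M.join a b) := by
  induction t with
  | var z =>
    rcases z with x | y
    · exact ⟨{x}, Set.finite_singleton x, fun S' h =>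
        ⟨Term.inl (Γ := fun x : S' => Γ x) ⟨x, h rfl⟩, fun M a b => rfl⟩⟩
    · exact ⟨∅, Set.finite_empty, fun S' h => ⟨Term.inr y, fun M a b => rfl⟩⟩
  | app f ts ih =>
    choose S hS h using ih
    refine ⟨⋃ i, S i, Set.finite_iUnion hS, fun S' hS' => ?_⟩
    choose ts' hts using fun i => h i S' ((Set.subset_iUnion S i).trans hS')
    exact ⟨.app f ts', fun M a b => by simp only [Term.eval, hts]⟩

theorem BFormula.exists_support {V : Type v} {Γ : V → L.Sorts} {n : ℕ} {E : Fin n → L.Sorts}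
    (φ : BFormula L Γ n E) :
    ∃ S : Set V, S.Finite ∧ ∀ S', S ⊆ S' →
      ∃ φ' : BFormula L (fun x : S' => Γ x) n E, ∀ (M : Str L)
        (a : (x : V) → M.carrier (Γ x)) (b : (i : Fin n) → M.carrier (E i)),
        φ'.Realize M (fun x : S' => a x) b ↔ φ.Realize M a b := by
  induction φ with
  | top => exact ⟨∅, Set.finite_empty, fun S' _ => ⟨.top, fun _ _ _ => Iff.rfl⟩⟩
  | bot => exact ⟨∅, Set.finite_empty, fun S' _ => ⟨.bot, fun _ _ _ => Iff.rfl⟩⟩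
  | eq t₁ t₂ =>
    obtain ⟨S₁, hS₁, h₁⟩ := t₁.exists_support
    obtain ⟨S₂, hS₂, h₂⟩ := t₂.exists_support
    refine ⟨S₁ ∪ S₂, hS₁.union hS₂, fun S' hS' => ?_⟩
    obtain ⟨r₁, hr₁⟩ := h₁ S' (Set.subset_union_left.trans hS')
    obtain ⟨r₂, hr₂⟩ := h₂ S' (Set.subset_union_right.trans hS')
    exact ⟨.eq r₁ r₂, fun M a b => by simp only [BFormula.Realize, hr₁, hr₂]⟩
  | rel R ts =>
    choose S hS h using fun i => (ts i).exists_support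
    refine ⟨⋃ i, S i, Set.finite_iUnion hS, fun S' hS' => ?_⟩
    choose ts' hts using fun i => h i S' ((Set.subset_iUnion S i).trans hS')
    exact ⟨.rel R ts', fun M a b => by simp only [BFormula.Realize, hts]⟩
  | and φ ψ ih₁ ih₂ =>
    obtain ⟨S₁, hS₁, h₁⟩ := ih₁
    obtain ⟨S₂, hS₂, h₂⟩ := ih₂
    refine ⟨S₁ ∪ S₂, hS₁.union hS₂, fun S' hS' => ?_⟩
    obtain ⟨r₁, hr₁⟩ := h₁ S' (Set.subset_union_left.trans hS')
    obtain ⟨r₂, hr₂⟩ := h₂ S' (Set.subset_union_right.trans hS')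
    exact ⟨.and r₁ r₂, fun M a b => and_congr (hr₁ M a b) (hr₂ M a b)⟩
  | or φ ψ ih₁ ih₂ =>
    obtain ⟨S₁, hS₁, h₁⟩ := ih₁
    obtain ⟨S₂, hS₂, h₂⟩ := ih₂
    refine ⟨S₁ ∪ S₂, hS₁.union hS₂, fun S' hS' => ?_⟩
    obtain ⟨r₁, hr₁⟩ := h₁ S' (Set.subset_union_left.trans hS')
    obtain ⟨r₂, hr₂⟩ := h₂ S' (Set.subset_union_right.trans hS')
    exact ⟨.or r₁ r₂, fun M a b => or_congr (hr₁ M a b) (hr₂ M a b)⟩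
  | ex s φ ih =>
    obtain ⟨S, hS, h⟩ := ih
    refine ⟨S, hS, fun S' hS' => ?_⟩
    obtain ⟨r, hr⟩ := h S' hS'
    exact ⟨.ex s r, fun M a b => exists_congr fun m => hr M a _⟩

/-- Only finitely many variables occur in a formula. -/
theorem Formula.exists_support {V : Type v} {Γ : V → L.Sorts} (φ : Formula L Γ) :
    ∃ S : Set V, S.Finite ∧ ∃ φ' : Formula L (fun x : S => Γ x), ∀ (M : Str L)
      (a : (x : V) → M.carrier (Γ x)), M.Sat φ' (fun x : S => a x) ↔ M.Sat φ a := by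
  obtain ⟨S, hS, h⟩ := BFormula.exists_support φ
  obtain ⟨φ', hφ'⟩ := h S subset_rfl
  exact ⟨S, hS, φ', fun M a => hφ' M a _⟩

/-- The definition of an immersion quantifies over tuples of variables indexed by `Fin n` only;
arbitrary families of variables reduce to these by passing to a finite support. -/
theorem Hom.IsImmersion.sat_iff {M N : Str L} {f : Hom M N} (hf : f.IsImmersion) {V : Type v}
    {Γ : V → L.Sorts} (φ : Formula L Γ) (a : (x : V) → M.carrier (Γ x)) :
    M.Sat φ a ↔ N.Sat φ (f.tuple a) := by
  obtain ⟨S, hS, φ', hφ'⟩ := φ.exists_support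
  have := hS.to_subtype
  obtain ⟨n, ⟨e⟩⟩ := Finite.exists_equiv_fin S
  rw [← hφ' M, ← hφ' N, ← Formula.sat_reindex M e, ← Formula.sat_reindex N e]
  exact hf n _ _ _

theorem PosDef.tuple_iff {V : Type v} {Γ : V → L.Sorts}
    {P : (M : Str L) → ((x : V) → M.carrier (Γ x)) → Prop} (hP : PosDef Γ P) {M N : Str L}
    {f : Hom M N} (hf : f.IsImmersion) {a : (x : V) → M.carrier (Γ x)} :
    P N (f.tuple a) ↔ P M a := by
  obtain ⟨φ, hφ⟩ := hP
  rw [← hφ, ← hφ]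
  exact (hf.sat_iff φ a).symm

/-! ### Ultraproducts and compactness -/

section Ultraproduct

variable {J : Type u} (U : Ultrafilter J) (K : J → Str L)

/-- Equality almost everywhere of families of elements of sort `s` that are defined almost
everywhere. Families with values in `Option` are used because the sort `s` may be empty in a few of
the factors while the ultraproduct should still have elements of sort `s`. -/
def ultraSetoid (s : L.Sorts) :
    Setoid {x : (i : J) → Option ((K i).carrier s) // ∀ᶠ i in U, (x i).isSome} where
  r x y := ∀ᶠ i in U, x.1 i = y.1 i
  iseqv := ⟨fun _ => .of_forall fun _ => rfl, fun h => h.mono fun _ => Eq.symm,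
    fun h h' => by filter_upwards [h, h'] with i using Eq.trans⟩

/-- A representative of an element of the ultraproduct. -/
noncomputable def ultraRep {s : L.Sorts} (x : Quotient (ultraSetoid U K s)) (i : J) :
    Option ((K i).carrier s) :=
  x.out.1 i

variable {U K} in
theorem eventually_ultraRep_mk {s : L.Sorts} (x : (i : J) → Option ((K i).carrier s))
    (h : ∀ᶠ i in U, (x i).isSome) :
    ∀ᶠ i in U, ultraRep U K (Quotient.mk (ultraSetoid U K s) ⟨x, h⟩) i = x i :=
  Quotient.mk_out (s := ultraSetoid U K s) ⟨x, h⟩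

variable {U K} in
theorem eventually_isSome_ultraRep {s : L.Sorts} (x : Quotient (ultraSetoid U K s)) :
    ∀ᶠ i in U, (ultraRep U K x i).isSome :=
  x.out.2

variable {U K} in
theorem ultraRep_eq_iff {s : L.Sorts} (x y : Quotient (ultraSetoid U K s)) :
    x = y ↔ ∀ᶠ i in U, ultraRep U K x i = ultraRep U K y i :=
  Quotient.out_equiv_out.symm

open Classical in
/-- The ultraproduct of the structures `K i`. -/
noncomputable def ultraproduct : Str L where
  carrier s := Quotient (ultraSetoid U K s)
  fn f xs := Quotient.mk _ ⟨fun i =>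
    if h : ∃ ys : (k : Fin (L.fnArity f)) → (K i).carrier (L.fnDom f k),
      ∀ k, ultraRep U K (xs k) i = some (ys k) then some ((K i).fn f h.choose) else none, by
    filter_upwards [Filter.eventually_all.2 fun k => eventually_isSome_ultraRep (xs k)] with i hi
    rw [dif_pos ⟨fun k => (ultraRep U K (xs k) i).get (hi k), fun k => by simp⟩]
    rfl⟩
  rel R xs := ∀ᶠ i in U, ∃ ys : (k : Fin (L.relArity R)) → (K i).carrier (L.relDom R k),
    (∀ k, ultraRep U K (xs k) i = some (ys k)) ∧ (K i).rel R ys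

/-- The tuple `a'` in the factor `K i` represents the tuple `a` in the ultraproduct. -/
def UltraMatch {V : Type v} {Γ : V → L.Sorts} (a : (x : V) → (ultraproduct U K).carrier (Γ x))
    (i : J) (a' : (x : V) → (K i).carrier (Γ x)) : Prop :=
  ∀ x, ultraRep U K (a x) i = some (a' x)

variable {U K} {V : Type v} {Γ : V → L.Sorts}

theorem UltraMatch.unique {a : (x : V) → (ultraproduct U K).carrier (Γ x)} {i : J}
    {a' a'' : (x : V) → (K i).carrier (Γ x)} (h : UltraMatch U K a i a')
    (h' : UltraMatch U K a i a'') : a' = a'' :=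
  funext fun x => Option.some_injective _ ((h x).symm.trans (h' x))

theorem UltraMatch.join {W : Type w} {Δ : W → L.Sorts}
    {a : (x : V) → (ultraproduct U K).carrier (Γ x)}
    {b : (x : W) → (ultraproduct U K).carrier (Δ x)} {i : J}
    {a' : (x : V) → (K i).carrier (Γ x)} {b' : (x : W) → (K i).carrier (Δ x)}
    (h : UltraMatch U K a i a') (h' : UltraMatch U K b i b') :
    UltraMatch U K ((ultraproduct U K).join a b) i ((K i).join a' b') := by
  rintro (x | y)
  · exact h x
  · exact h' y

theorem eventually_exists_ultraMatch [Finite V]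
    (a : (x : V) → (ultraproduct U K).carrier (Γ x)) :
    ∀ᶠ i in U, ∃ a', UltraMatch U K a i a' := by
  filter_upwards [Filter.eventually_all.2 fun x => eventually_isSome_ultraRep (a x)] with i hi
  exact ⟨fun x => (ultraRep U K (a x) i).get (hi x), fun x => by simp⟩

theorem eventually_ultraRep_eval (a : (x : V) → (ultraproduct U K).carrier (Γ x)) {s : L.Sorts}
    (t : Term L Γ s) :
    ∀ᶠ i in U, ∀ a', UltraMatch U K a i a' →
      ultraRep U K (t.eval (ultraproduct U K) a) i = some (t.eval (K i) a') := by
  induction t with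
  | var x => exact .of_forall fun i a' h => h x
  | app f ts ih =>
    filter_upwards [Filter.eventually_all.2 ih, eventually_ultraRep_mk _ _] with i hi hf a' ha'
    refine (hf.trans (dif_pos ⟨_, fun k => hi k a' ha'⟩)).trans ?_
    congr 2
    generalize_proofs h
    exact funext fun k => Option.some_injective _ ((h.choose_spec k).symm.trans (hi k a' ha'))

/-- Łoś's theorem for positive formulas. -/
theorem realize_ultraproduct [Finite V] (a : (x : V) → (ultraproduct U K).carrier (Γ x)) {n : ℕ}
    {E : Fin n → L.Sorts} (φ : BFormula L Γ n E)
    (b : (k : Fin n) → (ultraproduct U K).carrier (E k)) :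
    φ.Realize (ultraproduct U K) a b ↔ ∀ᶠ i in U, ∃ a' b', UltraMatch U K a i a' ∧
      UltraMatch U K b i b' ∧ φ.Realize (K i) a' b' := by
  have hab {n : ℕ} {E : Fin n → L.Sorts} (b : (k : Fin n) → (ultraproduct U K).carrier (E k)) :
      ∀ᶠ i in U, ∃ a' b', UltraMatch U K a i a' ∧ UltraMatch U K b i b' := by
    filter_upwards [eventually_exists_ultraMatch a, eventually_exists_ultraMatch b] with
      i ⟨a', ha⟩ ⟨b', hb⟩
    exact ⟨a', b', ha, hb⟩
  induction φ with
  | top =>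
    refine ⟨fun _ => ?_, fun _ => trivial⟩
    filter_upwards [hab b] with i ⟨a', b', ha, hb⟩
    exact ⟨a', b', ha, hb, trivial⟩
  | bot => exact ⟨False.elim, fun h => h.exists.elim fun i ⟨_, _, _, _, h⟩ => h⟩
  | eq t₁ t₂ =>
    refine (ultraRep_eq_iff _ _).trans (Filter.eventually_congr ?_)
    filter_upwards [hab b, eventually_ultraRep_eval _ t₁, eventually_ultraRep_eval _ t₂] with
      i ⟨a', b', ha, hb⟩ h₁ h₂
    rw [h₁ _ (ha.join hb), h₂ _ (ha.join hb), Option.some_inj]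
    constructor
    · intro h
      exact ⟨a', b', ha, hb, h⟩
    · rintro ⟨a'', b'', ha', hb', h⟩
      rwa [ha.unique ha', hb.unique hb']
  | rel R ts =>
    refine Filter.eventually_congr ?_
    filter_upwards [hab b, Filter.eventually_all.2 fun k => eventually_ultraRep_eval _ (ts k)] with
      i ⟨a', b', ha, hb⟩ h
    constructor
    · rintro ⟨ys, hys, hr⟩
      refine ⟨a', b', ha, hb, ?_⟩
      have : ys = fun k => (ts k).eval (K i) ((K i).join a' b') := funext fun k =>
        Option.some_injective _ ((hys k).symm.trans (h k _ (ha.join hb)))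
      rwa [this] at hr
    · rintro ⟨a'', b'', ha', hb', hr⟩
      exact ⟨_, fun k => h k _ (ha'.join hb'), hr⟩
  | and φ ψ ih₁ ih₂ =>
    refine (and_congr (ih₁ b) (ih₂ b)).trans (Filter.eventually_and.symm.trans ?_)
    refine Filter.eventually_congr (.of_forall fun i => ?_)
    constructor
    · rintro ⟨⟨a', b', ha, hb, h⟩, a'', b'', ha', hb', h'⟩
      obtain rfl := ha.unique ha'
      obtain rfl := hb.unique hb'
      exact ⟨a', b', ha, hb, h, h'⟩
    · rintro ⟨a', b', ha, hb, h, h'⟩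
      exact ⟨⟨a', b', ha, hb, h⟩, a', b', ha, hb, h'⟩
  | or φ ψ ih₁ ih₂ =>
    refine (or_congr (ih₁ b) (ih₂ b)).trans (Ultrafilter.eventually_or.symm.trans ?_)
    refine Filter.eventually_congr (.of_forall fun i => ?_)
    simp only [BFormula.Realize, ← exists_or, ← and_or_left]
  | @ex n E s φ ih =>
    constructor
    · rintro ⟨m, hm⟩
      filter_upwards [(ih _).1 hm] with i ⟨a', c, ha, hc, h⟩
      have key : (K i).cons (Δ := E) (s := s) (c 0) (fun k => c k.succ) = c := funext fun k => by
        refine Fin.cases ?_ (fun k => ?_) k <;> rfl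
      exact ⟨a', fun k => c k.succ, ha, fun k => hc k.succ, c 0,
        (congrArg (φ.Realize (K i) a') key).mpr h⟩
    · intro h
      classical
      let P (i : J) (m : (K i).carrier s) : Prop :=
        ∃ a' b', UltraMatch U K a i a' ∧ UltraMatch U K b i b' ∧
          φ.Realize (K i) a' ((K i).cons m b')
      let x (i : J) : Option ((K i).carrier s) :=
        if h : ∃ m, P i m then some h.choose else none
      have hP : ∀ᶠ i in U, ∃ m, P i m :=
        h.mono fun i ⟨a', b', ha, hb, m, hm⟩ => ⟨m, a', b', ha, hb, hm⟩
      have hx : ∀ᶠ i in U, (x i).isSome := hP.mono fun i hi => by simp [x, dif_pos hi]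
      refine ⟨Quotient.mk _ ⟨x, hx⟩, (ih _).2 ?_⟩
      filter_upwards [hP, eventually_ultraRep_mk x hx] with i hi hxi
      obtain ⟨a', b', ha, hb, h⟩ := hi.choose_spec
      refine ⟨a', _, ha, fun k => ?_, h⟩
      refine Fin.cases ?_ (fun k => ?_) k
      · exact hxi.trans (dif_pos hi)
      · exact hb k

theorem sat_ultraproduct [Finite V] (φ : Formula L Γ)
    (a : (x : V) → (ultraproduct U K).carrier (Γ x)) :
    (ultraproduct U K).Sat φ a ↔ ∀ᶠ i in U, ∃ a', UltraMatch U K a i a' ∧ (K i).Sat φ a' := by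
  refine (realize_ultraproduct a φ _).trans (Filter.eventually_congr (.of_forall fun i => ?_))
  constructor
  · rintro ⟨a', b', ha, -, h⟩
    rw [Subsingleton.elim b' (fun k : Fin 0 => k.elim0)] at h
    exact ⟨a', ha, h⟩
  · rintro ⟨a', ha, h⟩
    exact ⟨a', _, ha, fun k => k.elim0, h⟩

theorem Theory.IsModel.ultraproduct {T : Theory L} (h : ∀ i, T.IsModel (K i)) :
    T.IsModel (ultraproduct U K) := by
  intro χ hχ a ha
  rw [sat_ultraproduct] at ha ⊢
  filter_upwards [ha] with i ⟨a', hm, hs⟩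
  exact ⟨a', hm, h i χ hχ a' hs⟩

end Ultraproduct

/-- The compactness theorem, for formulas `φ j` in the variables `g j : W j → V`. Every finite set
of these formulas has to be satisfied by assignments to arbitrarily large finite sets of variables;
an assignment to all the variables need not exist as some sorts may be empty. -/
theorem compactness (T : Theory L) {V : Type u} (Γ : V → L.Sorts) {J : Type u} {W : J → Type v}
    [∀ j, Finite (W j)] (g : (j : J) → W j → V) (φ : (j : J) → Formula L (fun y => Γ (g j y)))
    (h : ∀ (F : Finset J) (G : Finset V), ∃ M : Str L, T.IsModel M ∧
      ∃ a : (x : V) → x ∈ G → M.carrier (Γ x),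
        ∀ j ∈ F, ∀ hj : ∀ y, g j y ∈ G, M.Sat (φ j) (fun y => a (g j y) (hj y))) :
    ∃ M : Str L, T.IsModel M ∧ ∃ a : (x : V) → M.carrier (Γ x),
      ∀ j, M.Sat (φ j) (fun y => a (g j y)) := by
  classical
  choose M hM a ha using fun p : Finset J × Finset V => h p.1 p.2
  let U : Ultrafilter (Finset J × Finset V) := Ultrafilter.of Filter.atTop
  have hU (p : Finset J × Finset V) : ∀ᶠ q in U, p ≤ q :=
    (Filter.eventually_ge_atTop p).filter_mono (Ultrafilter.of_le Filter.atTop)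
  let c (x : V) (p : Finset J × Finset V) : Option ((M p).carrier (Γ x)) :=
    if hx : x ∈ p.2 then some (a p x hx) else none
  have hc (x : V) : ∀ᶠ p in U, (c x p).isSome := by
    filter_upwards [hU (∅, {x})] with p hp
    have : x ∈ p.2 := hp.2 (by simp)
    simp [c, this]
  refine ⟨ultraproduct U M, .ultraproduct hM, fun x => Quotient.mk _ ⟨c x, hc x⟩, fun j => ?_⟩
  refine (sat_ultraproduct (φ j) _).2 ?_
  have := Fintype.ofFinite (W j)
  filter_upwards [hU ({j}, Finset.univ.image (g j)),
    Filter.eventually_all.2 fun y => eventually_ultraRep_mk (c (g j y)) (hc (g j y))] with p hp hrep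
  have hj : ∀ y, g j y ∈ p.2 := fun y => hp.2 (by simp)
  exact ⟨fun y => a p (g j y) (hj y), fun y => (hrep y).trans (dif_pos (hj y)),
    ha p j (hp.1 (by simp)) hj⟩

/-! ### Direct limits of chains -/

section Limit

variable (K : ℕ → Str L) (t : (n : ℕ) → Hom (K n) (K (n + 1)))

/-- The transition maps of the chain. -/
def trans (i : ℕ) {j : ℕ} (h : i ≤ j) : Hom (K i) (K j) :=
  Nat.leRec (motive := fun j _ => Hom (K i) (K j)) (Hom.id _) (fun j _ f => (t j).comp f) h

theorem trans_self {i : ℕ} {s : L.Sorts} (x : (K i).carrier s) :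
    (trans K t i le_rfl).toFun x = x := by
  rw [trans, Nat.leRec_self]
  rfl

theorem trans_succ {i j : ℕ} (h : i ≤ j) {s : L.Sorts} (x : (K i).carrier s) :
    (trans K t i (h.trans j.le_succ)).toFun x = (t j).toFun ((trans K t i h).toFun x) := by
  rw [trans, Nat.leRec_succ (h1 := h)]
  rfl

theorem trans_trans {i j k : ℕ} (h : i ≤ j) (h' : j ≤ k) {s : L.Sorts} (x : (K i).carrier s) :
    (trans K t j h').toFun ((trans K t i h).toFun x) = (trans K t i (h.trans h')).toFun x := by
  induction k, h' using Nat.le_induction with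
  | base => rw [trans_self]
  | succ k h' ih => rw [trans_succ _ _ h', trans_succ _ _ (h.trans h'), ih]

/-- Two elements of the chain are identified in the limit if they become equal eventually. -/
def limitSetoid (s : L.Sorts) : Setoid (Σ i, (K i).carrier s) where
  r x y := ∃ (k : ℕ) (hx : x.1 ≤ k) (hy : y.1 ≤ k),
    (trans K t x.1 hx).toFun x.2 = (trans K t y.1 hy).toFun y.2
  iseqv := ⟨fun x => ⟨x.1, le_rfl, le_rfl, rfl⟩, fun ⟨k, hx, hy, h⟩ => ⟨k, hy, hx, h.symm⟩, by
    rintro x y z ⟨k, hx, hy, h⟩ ⟨k', hy', hz, h'⟩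
    refine ⟨max k k', hx.trans (le_max_left _ _), hz.trans (le_max_right _ _), ?_⟩
    rw [← trans_trans K t hx (le_max_left _ _), h, trans_trans, ← trans_trans K t hz
      (le_max_right _ _), ← h', trans_trans]⟩

/-- The class in the limit of an element of the chain. -/
def limitMk (i : ℕ) {s : L.Sorts} (x : (K i).carrier s) : Quotient (limitSetoid K t s) :=
  Quotient.mk _ ⟨i, x⟩

variable {K t}

theorem limitMk_trans {i j : ℕ} (h : i ≤ j) {s : L.Sorts} (x : (K i).carrier s) :
    limitMk K t j ((trans K t i h).toFun x) = limitMk K t i x :=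
  Quotient.sound ⟨j, le_rfl, h, trans_self K t _⟩

theorem exists_limitMk {V : Type v} [Finite V] {Γ : V → L.Sorts}
    (a : (x : V) → Quotient (limitSetoid K t (Γ x))) (i : ℕ) :
    ∃ j, i ≤ j ∧ ∃ a' : (x : V) → (K j).carrier (Γ x), a = fun x => limitMk K t j (a' x) := by
  choose p hp using fun x => (a x).exists_rep
  obtain ⟨k, hk⟩ := (Set.finite_range fun x => (p x).1).bddAbove
  have hk' (x : V) : (p x).1 ≤ max i k := (hk ⟨x, rfl⟩).trans (le_max_right _ _)
  refine ⟨max i k, le_max_left _ _, fun x => (trans K t _ (hk' x)).toFun (p x).2,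
    funext fun x => ?_⟩
  rw [limitMk_trans, ← hp x]
  rfl

theorem exists_trans_eq {V : Type v} [Finite V] {Γ : V → L.Sorts} {i j : ℕ}
    {a : (x : V) → (K i).carrier (Γ x)} {b : (x : V) → (K j).carrier (Γ x)}
    (h : ∀ x, limitMk K t i (a x) = limitMk K t j (b x)) :
    ∃ (k : ℕ) (hi : i ≤ k) (hj : j ≤ k), (trans K t i hi).tuple a = (trans K t j hj).tuple b := by
  choose p hi hj hp using fun x => Quotient.exact (h x)
  obtain ⟨k, hk⟩ := (Set.finite_range p).bddAbove
  have hi' : i ≤ max k (max i j) := (le_max_left _ _).trans (le_max_right _ _)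
  have hj' : j ≤ max k (max i j) := (le_max_right _ _).trans (le_max_right _ _)
  refine ⟨_, hi', hj', funext fun x => ?_⟩
  have hx : p x ≤ max k (max i j) := (hk ⟨x, rfl⟩).trans (le_max_left _ _)
  have := congrArg (trans K t _ hx).toFun (hp x)
  rwa [trans_trans, trans_trans] at this

variable (K t)

/-- The direct limit of the chain. -/
noncomputable def limit : Str L where
  carrier s := Quotient (limitSetoid K t s)
  fn f xs := limitMk K t (exists_limitMk xs 0).choose
    ((K _).fn f (exists_limitMk xs 0).choose_spec.2.choose)
  rel R xs := ∃ (i : ℕ) (ys : (k : Fin (L.relArity R)) → (K i).carrier (L.relDom R k)),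
    (xs = fun k => limitMk K t i (ys k)) ∧ (K i).rel R ys

/-- The canonical homomorphisms into the direct limit. -/
noncomputable def toLimit (i : ℕ) : Hom (K i) (limit K t) where
  toFun x := limitMk K t i x
  map_fn f a := by
    have h := (exists_limitMk (fun k => limitMk K t i (a k)) 0).choose_spec.2.choose_spec
    obtain ⟨k, hi, hj, hk⟩ := exists_trans_eq fun x => congrFun h x
    refine (limitMk_trans hi _).symm.trans (Eq.trans ?_ (limitMk_trans hj _))
    rw [(trans K t i hi).map_fn, Hom.map_fn]
    exact congrArg (fun y => limitMk K t k ((K k).fn f y)) hk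
  map_rel R a h := ⟨i, a, rfl, h⟩

theorem toLimit_trans {i j : ℕ} (h : i ≤ j) {V : Type v} {Γ : V → L.Sorts}
    (a : (x : V) → (K i).carrier (Γ x)) :
    (toLimit K t j).tuple ((trans K t i h).tuple a) = (toLimit K t i).tuple a :=
  funext fun _ => limitMk_trans h _

theorem exists_realize_trans {V : Type v} [Finite V] {Γ : V → L.Sorts} {n : ℕ}
    {E : Fin n → L.Sorts} (φ : BFormula L Γ n E) (i : ℕ) (a : (x : V) → (K i).carrier (Γ x))
    (b : (k : Fin n) → (K i).carrier (E k))
    (h : φ.Realize (limit K t) ((toLimit K t i).tuple a) ((toLimit K t i).tuple b)) :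
    ∃ (j : ℕ) (hj : i ≤ j), φ.Realize (K j) ((trans K t i hj).tuple a)
      ((trans K t i hj).tuple b) := by
  have up {n : ℕ} {E : Fin n → L.Sorts} {φ : BFormula L Γ n E} {i : ℕ}
      {a : (x : V) → (K i).carrier (Γ x)} {b : (k : Fin n) → (K i).carrier (E k)}
      {j k : ℕ} {hj : i ≤ j} (hk : j ≤ k)
      (h : φ.Realize (K j) ((trans K t i hj).tuple a) ((trans K t i hj).tuple b)) :
      φ.Realize (K k) ((trans K t i (hj.trans hk)).tuple a)
        ((trans K t i (hj.trans hk)).tuple b) := by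
    have := (trans K t j hk).realize_tuple _ φ _ h
    rwa [show (trans K t j hk).tuple ((trans K t i hj).tuple a) = _ from
        funext fun x => trans_trans K t hj hk (a x),
      show (trans K t j hk).tuple ((trans K t i hj).tuple b) = _ from
        funext fun x => trans_trans K t hj hk (b x)] at this
  induction φ generalizing i with
  | top => exact ⟨i, le_rfl, trivial⟩
  | bot => exact h.elim
  | eq t₁ t₂ =>
    simp only [BFormula.Realize, ← Hom.tuple_join, Hom.eval_tuple] at h ⊢
    obtain ⟨k, hi, hj, hk⟩ := exists_trans_eq (V := Unit) fun _ => h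
    exact ⟨k, hi, congrFun hk ()⟩
  | rel R ts =>
    simp only [BFormula.Realize, ← Hom.tuple_join, Hom.eval_tuple] at h ⊢
    obtain ⟨j, ys, h, hr⟩ := h
    obtain ⟨k, hi, hj, hk⟩ := exists_trans_eq fun x => congrFun h x
    refine ⟨k, hi, ?_⟩
    change (K k).rel R ((trans K t i hi).tuple _)
    rw [hk]
    exact (trans K t j hj).map_rel R ys hr
  | and φ ψ ih₁ ih₂ =>
    obtain ⟨j, hj, h₁⟩ := ih₁ i a b h.1
    obtain ⟨k, hk, h₂⟩ := ih₂ i a b h.2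
    exact ⟨max j k, hj.trans (le_max_left _ _), up (le_max_left _ _) h₁,
      up (hj := hk) (le_max_right _ _) h₂⟩
  | or φ ψ ih₁ ih₂ =>
    rcases h with h | h
    · obtain ⟨j, hj, h⟩ := ih₁ i a b h
      exact ⟨j, hj, .inl h⟩
    · obtain ⟨j, hj, h⟩ := ih₂ i a b h
      exact ⟨j, hj, .inr h⟩
  | ex s φ ih =>
    obtain ⟨m, hm⟩ := h
    obtain ⟨j, hj, m', hm'⟩ := exists_limitMk (V := Unit) (fun _ => m) i
    obtain rfl : m = (toLimit K t j).toFun (m' ()) := congrFun hm' ()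
    rw [← toLimit_trans K t hj a, ← toLimit_trans K t hj b, ← Hom.tuple_cons] at hm
    obtain ⟨k, hk, h⟩ := ih j _ _ hm
    rw [Hom.tuple_cons] at h
    refine ⟨k, hj.trans hk, (trans K t j hk).toFun (m' ()), ?_⟩
    rwa [show (trans K t j hk).tuple ((trans K t i hj).tuple a) = _ from
        funext fun x => trans_trans K t hj hk (a x),
      show (trans K t j hk).tuple ((trans K t i hj).tuple b) = _ from
        funext fun x => trans_trans K t hj hk (b x)] at h

/-- A formula that holds in the limit holds at some stage of the chain. -/
theorem exists_sat_trans {V : Type v} [Finite V] {Γ : V → L.Sorts} (φ : Formula L Γ) (i : ℕ)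
    (a : (x : V) → (K i).carrier (Γ x)) (h : (limit K t).Sat φ ((toLimit K t i).tuple a)) :
    ∃ (j : ℕ) (hj : i ≤ j), (K j).Sat φ ((trans K t i hj).tuple a) := by
  obtain ⟨j, hj, h⟩ := exists_realize_trans K t φ i a (fun k => k.elim0) (by
    rwa [Subsingleton.elim ((toLimit K t i).tuple _) (fun k : Fin 0 => k.elim0)])
  refine ⟨j, hj, ?_⟩
  rwa [Subsingleton.elim ((trans K t i hj).tuple _) (fun k : Fin 0 => k.elim0)] at h

theorem Theory.IsModel.limit {T : Theory L} (h : ∀ i, T.IsModel (K i)) :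
    T.IsModel (limit K t) := by
  intro χ hχ a ha
  obtain ⟨i, -, a, rfl⟩ := exists_limitMk a 0
  obtain ⟨j, hj, hs⟩ := exists_sat_trans K t χ.φ i a ha
  have := (toLimit K t j).sat_tuple _ (h j χ hχ _ hs)
  rwa [toLimit_trans] at this

end Limit

/-! ### Positively closed continuations -/

/-- Formulas whose variables are named by finitely many elements of `M`. -/
abbrev DiagFormula (M : Str L) : Type u :=
  Σ S : Finset (Σ s, M.carrier s), Formula L (fun x : S => x.1.1)

/-- The elements of `N` assigned to those of `M` satisfy the formula `q`. -/
def DiagFormula.Sat {M : Str L} (q : DiagFormula M) (N : Str L)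
    (a : (x : Σ s, M.carrier s) → x ∈ q.1 → N.carrier x.1) : Prop :=
  N.Sat q.2 (fun x => a x.1 x.2)

/-- The positive diagram of `M`. -/
def diagram (M : Str L) : Set (DiagFormula M) := {q | q.Sat M fun x _ => x.2}

/-- A realisation of the positive diagram of `M` is a homomorphism. -/
theorem exists_hom_of_diagram {M N : Str L} (a : (x : Σ s, M.carrier s) → N.carrier x.1)
    (h : ∀ q ∈ diagram M, q.Sat N fun x _ => a x) :
    ∃ f : Hom M N, ∀ (s : L.Sorts) (m : M.carrier s), f.toFun m = a ⟨s, m⟩ := by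
  classical
  refine ⟨⟨fun {s} m => a ⟨s, m⟩, fun F xs => ?_, fun R xs hR => ?_⟩, fun _ _ => rfl⟩
  · let S : Finset (Σ s, M.carrier s) :=
      insert ⟨_, M.fn F xs⟩ (Finset.univ.image fun i => ⟨_, xs i⟩)
    obtain ⟨φ, hφ⟩ := PosDef.eq (Γ := fun x : S => x.1.1)
      (.var ⟨⟨_, M.fn F xs⟩, by simp [S]⟩)
      (.app F fun i => .var (Γ := fun x : S => x.1.1) ⟨⟨_, xs i⟩,
        Finset.mem_insert_of_mem (Finset.mem_image_of_mem _ (Finset.mem_univ i))⟩)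
    exact (hφ _ _).1 (h ⟨S, φ⟩ ((hφ _ _).2 rfl))
  · let S : Finset (Σ s, M.carrier s) := Finset.univ.image fun i => ⟨_, xs i⟩
    obtain ⟨φ, hφ⟩ := PosDef.rel (Γ := fun x : S => x.1.1) R
      fun i => .var (Γ := fun x : S => x.1.1) ⟨⟨_, xs i⟩,
        Finset.mem_image_of_mem _ (Finset.mem_univ i)⟩
    exact (hφ _ _).1 (h ⟨S, φ⟩ ((hφ _ _).2 hR))

namespace Theory

variable (T : Theory L)

/-- Compactness for sets of formulas with parameters in `M`, to be satisfied in a continuation. -/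
theorem exists_hom_of_finite (M : Str L) (Φ : Set (DiagFormula M))
    (h : ∀ F : Finset (DiagFormula M), ↑F ⊆ diagram M ∪ Φ → ∀ G : Finset (Σ s, M.carrier s),
      ∃ N : Str L, T.IsModel N ∧ ∃ a : (x : Σ s, M.carrier s) → x ∈ G → N.carrier x.1,
        ∀ q ∈ F, ∀ hq : q.1 ⊆ G, q.Sat N fun x hx => a x (hq hx)) :
    ∃ N : Str L, T.IsModel N ∧ ∃ f : Hom M N, ∀ q ∈ Φ, q.Sat N fun x _ => f.toFun x.2 := by
  classical
  obtain ⟨N, hN, a, ha⟩ := compactness T (V := Σ s, M.carrier s) Sigma.fst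
    (J := (diagram M ∪ Φ : Set _)) (W := fun q => q.1.1) (fun q x => x.1) (fun q => q.1.2) (by
      intro F G
      obtain ⟨N, hN, a, ha⟩ := h (F.map (Function.Embedding.subtype _))
        (by intro q; simp +contextual) G
      exact ⟨N, hN, a, fun q hq hG => ha q.1 (Finset.mem_map_of_mem _ hq) fun x hx => hG ⟨x, hx⟩⟩)
  obtain ⟨f, hf⟩ := exists_hom_of_diagram a fun q hq => ha ⟨q, .inl hq⟩
  refine ⟨N, hN, f, fun q hq => ?_⟩
  simp only [hf]
  exact ha ⟨q, .inr hq⟩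

/-- There is a continuation `N` of `M` such that the elements of `M` satisfy in `N` every formula
that they satisfy in some further continuation of `N`. Such an `N` realises a maximal set of
formulas with parameters in `M` that can be satisfied in a continuation of `M`. -/
theorem exists_maximal_continuation {M : Str L} (hM : T.IsModel M) :
    ∃ N : Str L, T.IsModel N ∧ ∃ f : Hom M N, ∀ K : Str L, T.IsModel K → ∀ g : Hom N K,
      ∀ (n : ℕ) (Γ : Fin n → L.Sorts) (φ : Formula L Γ) (a : (i : Fin n) → M.carrier (Γ i)),
        K.Sat φ (g.tuple (f.tuple a)) → N.Sat φ (f.tuple a) := by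
  classical
  let 𝒢 : Set (Set (DiagFormula M)) := {Φ | ∃ N : Str L, T.IsModel N ∧ ∃ f : Hom M N, ∀ q ∈ Φ,
    q.Sat N fun x _ => f.toFun x.2}
  obtain ⟨Φ, hΦ⟩ := zorn_subset 𝒢 (by
    intro c hc hchain
    rcases c.eq_empty_or_nonempty with rfl | hne
    · exact ⟨∅, ⟨M, hM, Hom.id M, by simp⟩, by simp⟩
    refine ⟨⋃₀ c, T.exists_hom_of_finite M _ fun F hF G => ?_, fun s => Set.subset_sUnion_of_mem⟩
    obtain ⟨Ψ, hΨ, hFΨ⟩ := hchain.directedOn.exists_mem_subset_of_finite_of_subset_sUnion hne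
      (s := {q ∈ F | q ∈ ⋃₀ c}) (F.finite_toSet.subset fun q hq => hq.1) (fun q hq => hq.2)
    obtain ⟨N, hN, f, hf⟩ := hc hΨ
    refine ⟨N, hN, fun x _ => f.toFun x.2, fun q hq _ => ?_⟩
    rcases hF hq with h | h
    · exact f.sat_tuple _ h
    · exact hf q (hFΨ ⟨hq, h⟩))
  obtain ⟨N, hN, f, hf⟩ := hΦ.1
  refine ⟨N, hN, f, fun K hK g n Γ φ a h => ?_⟩
  let S : Finset (Σ s, M.carrier s) := Finset.univ.image fun i => ⟨_, a i⟩
  obtain ⟨φ', hφ'⟩ := (PosDef.sat φ).subst (Δ := fun x : S => x.1.1)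
    fun i => .var (Γ := fun x : S => x.1.1) ⟨⟨_, a i⟩,
      Finset.mem_image_of_mem _ (Finset.mem_univ i)⟩
  have hmem : (⟨S, φ'⟩ : DiagFormula M) ∈ Φ := by
    refine hΦ.2 (y := insert ⟨S, φ'⟩ Φ) ⟨K, hK, g.comp f, ?_⟩ (Set.subset_insert _ _)
      (Set.mem_insert _ _)
    rintro q (rfl | hq)
    · exact (hφ' _ _).2 h
    · exact g.sat_tuple _ (hf q hq)
  exact (hφ' _ _).1 (hf _ hmem)

/-- Every model continues to a p.c. model. -/
theorem exists_isPC {M : Str L} (hM : T.IsModel M) :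
    ∃ N : Str L, T.IsPC N ∧ Nonempty (Hom M N) := by
  choose N hN f hf using fun K : {K : Str L // T.IsModel K} => T.exists_maximal_continuation K.2
  let C : ℕ → {K : Str L // T.IsModel K} := fun n => Nat.rec ⟨M, hM⟩ (fun _ K => ⟨N K, hN K⟩) n
  let t (n : ℕ) : Hom (C n).1 (C (n + 1)).1 := f (C n)
  let K (n : ℕ) : Str L := (C n).1
  refine ⟨limit K t, ⟨.limit K t fun n => (C n).2, fun P hP g n Γ φ a =>
    ⟨g.sat_tuple a, fun h => ?_⟩⟩, ⟨toLimit K t 0⟩⟩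
  obtain ⟨i, -, a, rfl⟩ := exists_limitMk a 0
  have hi : (toLimit K t (i + 1)).tuple ((t i).tuple a) = (toLimit K t i).tuple a := by
    rw [← toLimit_trans K t i.le_succ]
    congr 1
    funext x
    exact ((trans_succ K t le_rfl _).trans (congrArg _ (trans_self K t _))).symm
  have := hf (C i) P hP (g.comp (toLimit K t (i + 1))) n Γ φ a (by
    change P.Sat φ (g.tuple ((toLimit K t (i + 1)).tuple ((t i).tuple a)))
    rw [hi]
    exact h)
  have := (toLimit K t (i + 1)).sat_tuple _ this
  rwa [show (toLimit K t (i + 1)).tuple ((f (C i)).tuple a) = _ from hi] at this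

/-- If a tuple in a p.c. model does not satisfy `φ`, then it satisfies a formula that contradicts
`φ` modulo `T`. -/
theorem IsPC.exists_contradictory {T : Theory L} {N : Str L} (hN : T.IsPC N) {V : Type u}
    [Finite V] {Γ : V → L.Sorts} (φ : Formula L Γ) (a : (x : V) → N.carrier (Γ x))
    (h : ¬ N.Sat φ a) : ∃ ψ : Formula L Γ, T.Contradictory φ ψ ∧ N.Sat ψ a := by
  classical
  have := Fintype.ofFinite V
  by_contra! hψ
  let S : Finset (Σ s, N.carrier s) := Finset.univ.image fun x => ⟨_, a x⟩
  have hS (x : V) : (⟨_, a x⟩ : Σ s, N.carrier s) ∈ S :=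
    Finset.mem_image_of_mem _ (Finset.mem_univ x)
  obtain ⟨φ', hφ'⟩ := (PosDef.sat φ).subst (Δ := fun x : S => x.1.1)
    fun x => .var (Γ := fun x : S => x.1.1) ⟨⟨_, a x⟩, hS x⟩
  obtain ⟨K, hK, f, hf⟩ := T.exists_hom_of_finite N {⟨S, φ'⟩} (by
    intro F hF G
    -- The formula `ψ(y)` says that some tuple with index set `G` satisfies the formulas of the
    -- diagram that occur in `F`, and has the part of `y` that `G` names among its entries.
    let Δ : G → L.Sorts := fun x => x.1.1
    obtain ⟨ψ, hψ'⟩ := PosDef.exists_tuple (Γ := Γ) (Δ := Δ) <|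
      (PosDef.all (Γ := Sum.elim Γ Δ) (F.filter fun q => q ∈ diagram N)
        (P := fun q M c => ∀ hq : q.1 ⊆ G, q.Sat M fun x hx => c (Sum.inr ⟨x, hq hx⟩)) (by
          intro q _
          by_cases hq : q.1 ⊆ G
          · refine ((PosDef.sat q.2).subst (Δ := Sum.elim Γ Δ)
              fun x => Term.inr (Δ := Δ) ⟨x.1, hq x.2⟩).congr fun M c => ?_
            exact ⟨fun h _ => h, fun h => h hq⟩
          · exact PosDef.true.congr fun M c => by simp [hq])).and
      (PosDef.all (Γ := Sum.elim Γ Δ) Finset.univ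
        (P := fun (x : V) M c => ∀ hx : (⟨_, a x⟩ : Σ s, N.carrier s) ∈ G,
          c (Sum.inr ⟨_, hx⟩) = c (Sum.inl x)) (by
          intro x _
          by_cases hx : (⟨_, a x⟩ : Σ s, N.carrier s) ∈ G
          · exact (PosDef.eq (Γ := Sum.elim Γ Δ) (Term.inr (Δ := Δ) ⟨_, hx⟩) (Term.inl x)).congr
              fun M c => ⟨fun h _ => h, fun h => h hx⟩
          · exact PosDef.true.congr fun M c => by simp [hx]))
    have hsat : N.Sat ψ a :=
      (hψ' N a).2 ⟨fun x => x.1.2, fun q hq _ => (Finset.mem_filter.1 hq).2, fun x _ _ => rfl⟩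
    have hcon : ¬ T.Contradictory φ ψ := fun hc => hψ ψ hc hsat
    simp only [Contradictory, not_forall, not_not] at hcon
    obtain ⟨M, hM, e, hφe, hψe⟩ := hcon
    obtain ⟨z, hz, hz'⟩ := (hψ' M e).1 hψe
    refine ⟨M, hM, fun x hx => z ⟨x, hx⟩, fun q hq hqG => ?_⟩
    rcases hF hq with h | rfl
    · exact hz q (Finset.mem_filter.2 ⟨hq, h⟩) hqG
    · refine (hφ' _ _).2 ?_
      convert hφe using 1
      funext x
      exact hz' x (Finset.mem_univ x) (hqG (hS x)))
  exact h (((hN.2 K hK f).sat_iff φ a).2 ((hφ' _ _).1 (hf _ rfl)))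

end Theory

/-! ### Ranks and binary trees -/

section Trees

/-- There is a binary tree of height `k` of instances of `φ` and `ψ` with parameters in `M` all of
whose branches are realised in the set `X` of tuples. This is what it means for the rank of `X` to
be at least `k`, except that no continuations of `M` are used. -/
def HasTree {M : Str L} {I : Type u} {σ : I → L.Sorts} {n : ℕ} {τ : Fin n → L.Sorts}
    (φ ψ : Formula L (Sum.elim σ τ)) : ℕ → Set ((i : I) → M.carrier (σ i)) → Prop
  | 0, X => X.Nonempty
  | k + 1, X => ∃ b : (j : Fin n) → M.carrier (τ j),
      HasTree φ ψ k (X ∩ {a | M.Sat φ (M.join a b)}) ∧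
      HasTree φ ψ k (X ∩ {a | M.Sat ψ (M.join a b)})

variable {I : Type u} {σ : I → L.Sorts} {n : ℕ} {τ : Fin n → L.Sorts}
  {φ ψ : Formula L (Sum.elim σ τ)}

theorem HasTree.mono {M : Str L} {k : ℕ} {X Y : Set ((i : I) → M.carrier (σ i))}
    (h : HasTree φ ψ k X) (hXY : X ⊆ Y) : HasTree φ ψ k Y := by
  induction k generalizing X Y with
  | zero => exact Set.Nonempty.mono hXY h
  | succ k ih =>
    obtain ⟨b, h₁, h₂⟩ := h
    exact ⟨b, ih h₁ (Set.inter_subset_inter_left _ hXY), ih h₂ (Set.inter_subset_inter_left _ hXY)⟩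

/-- That the solution set of `Θ(x, z)` has a tree of height `k` is expressed by a positive formula
in `z`. -/
theorem PosDef.hasTree [Finite I] (φ ψ : Formula L (Sum.elim σ τ)) (k : ℕ) {V : Type v}
    {Γ : V → L.Sorts} {Θ : (M : Str L) → ((x : I ⊕ V) → M.carrier (Sum.elim σ Γ x)) → Prop}
    (hΘ : PosDef (Sum.elim σ Γ) Θ) :
    PosDef Γ (fun M c => HasTree φ ψ k {a | Θ M (M.join a c)}) := by
  induction k generalizing V with
  | zero =>
    let t : (z : I ⊕ V) → Term L (Sum.elim Γ σ) (Sum.elim σ Γ z)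
      | Sum.inl i => Term.inr i
      | Sum.inr x => Term.inl x
    refine (PosDef.exists_tuple (hΘ.subst t)).congr fun M c => exists_congr fun a => ?_
    refine iff_of_eq (congrArg (Θ M) (funext ?_))
    rintro (i | x) <;> rfl
  | succ k ih =>
    let t : (z : I ⊕ V) → Term L (Sum.elim σ (Sum.elim Γ τ)) (Sum.elim σ Γ z)
      | Sum.inl i => Term.inl i
      | Sum.inr x => Term.inr (Δ := Sum.elim Γ τ) (Sum.inl x)
    let r : (z : I ⊕ Fin n) → Term L (Sum.elim σ (Sum.elim Γ τ)) (Sum.elim σ τ z)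
      | Sum.inl i => Term.inl i
      | Sum.inr j => Term.inr (Δ := Sum.elim Γ τ) (Sum.inr j)
    have key (χ : Formula L (Sum.elim σ τ)) : PosDef (Sum.elim Γ τ) fun M z =>
        HasTree φ ψ k ({a | Θ M (M.join a fun x => z (Sum.inl x))} ∩
          {a | M.Sat χ (M.join a fun j => z (Sum.inr j))}) := by
      refine (ih ((hΘ.subst t).and ((PosDef.sat χ).subst r))).congr fun M z => ?_
      refine iff_of_eq (congrArg _ (Set.ext fun a => and_congr (iff_of_eq ?_) (iff_of_eq ?_)))
      · refine congrArg (Θ M) (funext ?_)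
        rintro (i | x) <;> rfl
      · refine congrArg (M.Sat χ) (funext ?_)
        rintro (i | x) <;> rfl
    exact PosDef.exists_tuple ((key φ).and (key ψ))

namespace PFormula

variable {M N : Str L}

/-- The conjunction of a formula over `M` and the formula `χ(x, b)`. -/
theorem exists_inter (p : PFormula M σ) (χ : Formula L (Sum.elim σ τ))
    (b : (j : Fin n) → M.carrier (τ j)) :
    ∃ q : PFormula M σ, (∀ B : Set (Σ s, M.carrier s), p.Over B → (∀ j, ⟨τ j, b j⟩ ∈ B) →
      q.Over B) ∧ ∀ (N : Str L) (f : Hom M N) (a : (i : I) → N.carrier (σ i)),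
        (q.map f).Sat a ↔ (p.map f).Sat a ∧ N.Sat χ (N.join a (f.tuple b)) := by
  let ρ (z : Fin p.n ⊕ Fin n) : L.Sorts := Sum.elim p.τ τ z
  let e : Fin p.n ⊕ Fin n ≃ Fin (p.n + n) := finSumFinEquiv
  let t : (z : I ⊕ Fin p.n) → Term L (Sum.elim σ fun y => ρ (e.symm y)) (Sum.elim σ p.τ z)
    | Sum.inl i => Term.inl i
    | Sum.inr j => (Term.reindexVar ρ e (Sum.inl j)).subst (Term.inr (Δ := fun y => ρ (e.symm y)))
  let r : (z : I ⊕ Fin n) → Term L (Sum.elim σ fun y => ρ (e.symm y)) (Sum.elim σ τ z)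
    | Sum.inl i => Term.inl i
    | Sum.inr j => (Term.reindexVar ρ e (Sum.inr j)).subst (Term.inr (Δ := fun y => ρ (e.symm y)))
  obtain ⟨θ, hθ⟩ := ((PosDef.sat p.φ).subst t).and ((PosDef.sat χ).subst r)
  refine ⟨⟨p.n + n, fun y => ρ (e.symm y), θ, fun y => M.join p.b b (e.symm y)⟩, ?_, ?_⟩
  · intro B hp hb j
    have key : ∀ z, (⟨ρ z, M.join p.b b z⟩ : Σ s, M.carrier s) ∈ B := by
      rintro (k | k)
      · exact hp k
      · exact hb k
    exact key (e.symm j)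
  · intro N f a
    refine (hθ N _).trans (and_congr (iff_of_eq ?_) (iff_of_eq ?_))
    · refine congrArg (N.Sat p.φ) (funext ?_)
      rintro (i | j)
      · rfl
      · refine (Term.eval_subst N _ _ _).trans ?_
        exact Term.eval_reindexVar N e (f.tuple (M.join p.b b)) (Sum.inl j)
    · refine congrArg (N.Sat χ) (funext ?_)
      rintro (i | j)
      · rfl
      · refine (Term.eval_subst N _ _ _).trans ?_
        exact Term.eval_reindexVar N e (f.tuple (M.join p.b b)) (Sum.inr j)

/-- Trees in the solution sets of formulas over a p.c. model are not affected by continuations. -/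
theorem hasTree_map_iff [Finite I] {f : Hom M N} (hf : f.IsImmersion) (k : ℕ) (p : PFormula M σ) :
    HasTree φ ψ k {a | (p.map f).Sat a} ↔ HasTree φ ψ k {a | p.Sat a} :=
  (PosDef.hasTree φ ψ k (PosDef.sat p.φ)).tuple_iff hf

end PFormula

namespace Theory

variable {T : Theory L}

/-- If the set `S` of formulas over a p.c. model has rank at least `k` and implies the single
formula `θ`, then there is a tree of height `k` in the solution set of `θ`. The tree is found in a
continuation, and then in the model itself as its existence is expressed by a positive formula. -/
theorem RankGE.hasTree [Finite I] {α : Ordinal.{u}} {M : Str L} {S : Set (PFormula M σ)}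
    (h : T.RankGE φ ψ α M S) (hM : T.IsPC M) (k : ℕ) (hk : (k : Ordinal.{u}) ≤ α)
    (θ : PFormula M σ) (hθ : ∀ (N : Str L) (f : Hom M N) (a : (i : I) → N.carrier (σ i)),
      (∀ q ∈ S, (q.map f).Sat a) → (θ.map f).Sat a) :
    HasTree φ ψ k {a | θ.Sat a} := by
  induction h generalizing k with
  | zero M S hS =>
    obtain rfl : k = 0 := by simpa using hk
    obtain ⟨N, hN, f, a, ha⟩ := hS
    exact (θ.hasTree_map_iff (hM.2 N hN.1 f) 0).1 ⟨a, hθ N f a ha⟩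
  | succ α M S N hN f b _ _ ih₁ ih₂ =>
    rw [← θ.hasTree_map_iff (hM.2 N hN.1 f)]
    have key (χ : Formula L (Sum.elim σ τ)) : ∃ q : PFormula N σ,
        (∀ (K : Str L) (g : Hom N K) (a : (i : I) → K.carrier (σ i)),
          (∀ q ∈ PFormula.map f '' S ∪ {⟨n, τ, χ, b⟩}, (q.map g).Sat a) → (q.map g).Sat a) ∧
        {a | q.Sat a} = {a | (θ.map f).Sat a} ∩ {a | N.Sat χ (N.join a b)} := by
      obtain ⟨q, -, hq⟩ := (θ.map f).exists_inter χ b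
      refine ⟨q, fun K g a ha => (hq K g a).2 ⟨?_, ha _ (.inr rfl)⟩,
        Set.ext fun a => hq N (Hom.id N) a⟩
      exact hθ K (g.comp f) a fun q hq => ha _ (.inl ⟨q, hq, rfl⟩)
    obtain ⟨q₁, hq₁, h₁⟩ := key φ
    obtain ⟨q₂, hq₂, h₂⟩ := key ψ
    cases k with
    | zero =>
      have := ih₁ hN 0 (by simp) q₁ hq₁
      rw [h₁] at this
      exact this.mono Set.inter_subset_left
    | succ k =>
      have hk' : (k : Ordinal.{u}) ≤ α := by
        rw [Nat.cast_succ] at hk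
        exact Order.succ_le_succ_iff.1 hk
      exact ⟨b, h₁ ▸ ih₁ hN k hk' q₁ hq₁, h₂ ▸ ih₂ hN k hk' q₂ hq₂⟩
  | limit l M S hl _ ih =>
    have hlt : (k : Ordinal.{u}) < l := by
      refine lt_of_le_of_ne hk ?_
      rintro rfl
      rcases k with _ | k
      · exact hl.ne_bot (by simp)
      · rw [Nat.cast_succ] at hl
        exact Order.not_isSuccLimit_succ _ hl
    exact ih k hlt hM k le_rfl θ hθ

theorem rankGE_of_hasTree {M : Str L} (hM : T.IsPC M) {S : Set (PFormula M σ)} {k : ℕ}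
    {X : Set ((i : I) → M.carrier (σ i))} (h : HasTree φ ψ k X) (hX : ∀ a ∈ X, ∀ q ∈ S, q.Sat a) :
    T.RankGE φ ψ k M S := by
  induction k generalizing X S with
  | zero =>
    obtain ⟨a, ha⟩ := h
    rw [Nat.cast_zero]
    exact .zero M S ⟨M, hM, Hom.id M, a, hX a ha⟩
  | succ k ih =>
    obtain ⟨b, h₁, h₂⟩ := h
    rw [Nat.cast_succ]
    refine .succ _ M S M hM (Hom.id M) b (ih h₁ ?_) (ih h₂ ?_)
    all_goals
      rintro a ⟨ha, hb⟩ q (⟨q, hq, rfl⟩ | rfl)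
      · exact hX a ha q hq
      · exact hb

theorem coe_le_rank {α : Ordinal.{u}} {M : Str L} {S : Set (PFormula M σ)}
    (h : T.RankGE φ ψ α M S) :
    ((α : WithTop Ordinal.{u}) : WithBot (WithTop Ordinal.{u})) ≤ T.rank φ ψ M S :=
  le_sSup ⟨α, h, rfl⟩

/-- The rank of `x = x` is finite if and only if the heights of trees are bounded. -/
theorem rank_selfEq_lt_omega0_iff [Finite I] {M : Str L} (hM : T.IsPC M) :
    T.rank φ ψ M (selfEq M σ) <
      ((Ordinal.omega0 : WithTop Ordinal.{u}) : WithBot (WithTop Ordinal.{u})) ↔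
    ∃ k, ¬ HasTree (M := M) φ ψ k Set.univ := by
  constructor
  · intro h
    by_contra! hk
    refine h.not_ge ?_
    have key (k : ℕ) : (((k : Ordinal.{u}) : WithTop Ordinal.{u}) : WithBot (WithTop Ordinal.{u}))
        ≤ T.rank φ ψ M (selfEq M σ) := coe_le_rank (rankGE_of_hasTree hM (hk k) (by
      rintro a - q ⟨i, rfl⟩
      exact rfl))
    generalize T.rank φ ψ M (selfEq M σ) = r at key
    induction r with
    | bot => exact absurd (key 0) (by simp)
    | coe r =>
      induction r with
      | top => exact WithBot.coe_le_coe.2 le_top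
      | coe r =>
        simp only [WithBot.coe_le_coe, WithTop.coe_le_coe] at key ⊢
        exact Ordinal.omega0_le.2 key
  · rintro ⟨k, hk⟩
    refine lt_of_le_of_lt (sSup_le ?_)
      (WithBot.coe_lt_coe.2 (WithTop.coe_lt_coe.2 (Ordinal.natCast_lt_omega0 k)))
    rintro _ ⟨α, hα, rfl⟩
    simp only [WithBot.coe_le_coe, WithTop.coe_le_coe]
    by_contra! hlt
    refine hk ((hα.hasTree hM k hlt.le ⟨0, Fin.elim0, .top, fun j => j.elim0⟩
      fun _ _ _ _ => trivial).mono (Set.subset_univ _))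

end Theory

end Trees

/-! ### Codes for formulas modulo equivalence -/

section Definability

namespace Theory

variable (T : Theory L)

/-- The formulas in finitely many variables, up to equivalence modulo `T`. -/
abbrev Codes : Type u := Σ n : ℕ, Σ Γ : Fin n → L.Sorts, Quotient (T.equivSetoid Γ)

variable {I : Type v} {m : ℕ} (e : I ≃ Fin m)

/-- The variables `x, y` in one row, where `x` is enumerated by `e`. -/
def rowEquiv (n : ℕ) : I ⊕ Fin n ≃ Fin (m + n) :=
  (Equiv.sumCongr e (Equiv.refl _)).trans finSumFinEquiv

/-- The class modulo `T` of a formula `φ(x, y)`. -/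
def code {σ : I → L.Sorts} {n : ℕ} {τ : Fin n → L.Sorts} (φ : Formula L (Sum.elim σ τ)) : T.Codes :=
  ⟨m + n, fun y => Sum.elim σ τ ((rowEquiv e n).symm y),
    Quotient.mk _ (φ.reindex (rowEquiv e n))⟩

variable {T} {e} {σ σ' : I → L.Sorts} {n n' : ℕ} {τ τ' : Fin n → L.Sorts}

theorem length_eq_of_code_eq {τ' : Fin n' → L.Sorts} {φ : Formula L (Sum.elim σ τ)}
    {φ' : Formula L (Sum.elim σ' τ')} (h : T.code e φ = T.code e φ') : n = n' :=
  Nat.add_left_cancel (congrArg Sigma.fst h)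

theorem sumElim_eq_of_code_eq {φ : Formula L (Sum.elim σ τ)} {φ' : Formula L (Sum.elim σ' τ')}
    (h : T.code e φ = T.code e φ') : Sum.elim σ τ = Sum.elim σ' τ' := by
  simp only [code, Sigma.mk.injEq, heq_eq_eq, true_and] at h
  funext z
  simpa using congrFun h.1 (rowEquiv e n z)

theorem sorts_eq_of_code_eq {φ : Formula L (Sum.elim σ τ)} {φ' : Formula L (Sum.elim σ' τ')}
    (h : T.code e φ = T.code e φ') : τ = τ' :=
  funext fun j => congrFun (sumElim_eq_of_code_eq h) (Sum.inr j)

theorem sat_iff_of_code_eq {φ φ' : Formula L (Sum.elim σ τ)} (h : T.code e φ = T.code e φ')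
    {M : Str L} (hM : T.IsModel M) (a : (z : I ⊕ Fin n) → M.carrier (Sum.elim σ τ z)) :
    M.Sat φ a ↔ M.Sat φ' a := by
  simp only [code, Sigma.mk.injEq, heq_eq_eq, true_and] at h
  rw [← Formula.sat_reindex M (rowEquiv e n), ← Formula.sat_reindex M (rowEquiv e n)]
  exact Quotient.exact h M hM _

end Theory

/-! ### Definability of types -/

variable {T : Theory L}

/-- Given a type `tp(a/B)`, choose `k` maximal such that all formulas in the type have trees of
height `k`, and a formula `θ` in the type without trees of height `k + 1`. Then `d(y)` says that
`θ(x) ∧ φ(x, y)` still has a tree of height `k`: this holds if `φ(x, y)` is in the type, and it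
excludes that `ψ(x, y)` is. -/
theorem exists_separating_formula {M N : Str L} (hM : T.IsPC M) (hN : T.IsPC N) (f : Hom M N)
    {I : Type u} [Finite I] {σ : I → L.Sorts} (a : (i : I) → N.carrier (σ i))
    (B : Set (Σ s, M.carrier s)) {n : ℕ} {τ : Fin n → L.Sorts} (φ ψ : Formula L (Sum.elim σ τ))
    (h : ∃ k, ¬ HasTree (M := M) φ ψ k Set.univ) :
    ∃ d : PFormula M τ, d.Over B ∧ ∀ b : (j : Fin n) → M.carrier (τ j), (∀ j, ⟨τ j, b j⟩ ∈ B) →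
      (N.Sat φ (N.join a (f.tuple b)) → d.Sat b) ∧
      (N.Sat ψ (N.join a (f.tuple b)) → ¬ d.Sat b) := by
  classical
  have himm := hM.2 N hN.1 f
  have hex : ∃ k, ∃ θ : PFormula M σ, θ.Over B ∧ (θ.map f).Sat a ∧
      ¬ HasTree φ ψ k {x | θ.Sat x} := by
    obtain ⟨k, hk⟩ := h
    exact ⟨k, ⟨0, Fin.elim0, .top, fun j => j.elim0⟩, fun j => j.elim0, trivial,
      fun h => hk (h.mono (Set.subset_univ _))⟩
  obtain ⟨θ, hθB, hθ, hnot⟩ := Nat.find_spec hex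
  have hmin := fun k => Nat.find_min (m := k) hex
  generalize Nat.find hex = k at hnot hmin
  cases k with
  | zero => exact absurd ((θ.hasTree_map_iff himm 0).1 ⟨a, hθ⟩) hnot
  | succ k =>
    have hk (q : PFormula M σ) (hqB : q.Over B) (hq : (q.map f).Sat a) :
        HasTree φ ψ k {x | q.Sat x} := by
      by_contra hnot
      exact hmin k k.lt_succ_self ⟨q, hqB, hq, hnot⟩
    have hinter (χ : Formula L (Sum.elim σ τ)) (b : (j : Fin n) → M.carrier (τ j))
        (hb : ∀ j, (⟨τ j, b j⟩ : Σ s, M.carrier s) ∈ B) (h : N.Sat χ (N.join a (f.tuple b))) :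
        HasTree φ ψ k ({x | θ.Sat x} ∩ {x | M.Sat χ (M.join x b)}) := by
      obtain ⟨q, hqB, hq⟩ := θ.exists_inter χ b
      refine (hk q (hqB B hθB hb) ((hq N f a).2 ⟨hθ, h⟩)).mono fun x hx => ?_
      exact (hq M (Hom.id M) x).1 hx
    let t : (z : I ⊕ Fin θ.n) → Term L (Sum.elim σ (Sum.elim τ θ.τ)) (Sum.elim σ θ.τ z)
      | Sum.inl i => Term.inl i
      | Sum.inr j => Term.inr (Δ := Sum.elim τ θ.τ) (Sum.inr j)
    let r : (z : I ⊕ Fin n) → Term L (Sum.elim σ (Sum.elim τ θ.τ)) (Sum.elim σ τ z)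
      | Sum.inl i => Term.inl i
      | Sum.inr j => Term.inr (Δ := Sum.elim τ θ.τ) (Sum.inl j)
    obtain ⟨d, hd⟩ := PosDef.hasTree φ ψ k
      (((PosDef.sat θ.φ).subst t).and ((PosDef.sat φ).subst r))
    have hd' (b : (j : Fin n) → M.carrier (τ j)) : (⟨θ.n, θ.τ, d, θ.b⟩ : PFormula M τ).Sat b ↔
        HasTree φ ψ k ({x | θ.Sat x} ∩ {x | M.Sat φ (M.join x b)}) := by
      refine (hd M (M.join b θ.b)).trans (iff_of_eq (congrArg _ (Set.ext fun x => ?_)))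
      refine and_congr (iff_of_eq ?_) (iff_of_eq ?_)
      · refine congrArg (M.Sat θ.φ) (funext ?_)
        rintro (i | j) <;> rfl
      · refine congrArg (M.Sat φ) (funext ?_)
        rintro (i | j) <;> rfl
    refine ⟨⟨θ.n, θ.τ, d, θ.b⟩, hθB, fun b hb => ⟨fun h => (hd' b).2 (hinter φ b hb h), ?_⟩⟩
    exact fun h hdb => hnot ⟨b, (hd' b).1 hdb, hinter ψ b hb h⟩

/-- The definition of `φ` consists of one formula for each formula that contradicts `φ`. -/
theorem exists_definition {M N : Str L} (hM : T.IsPC M) (hN : T.IsPC N) (f : Hom M N)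
    {I : Type u} [Finite I] {σ : I → L.Sorts} (a : (i : I) → N.carrier (σ i))
    (B : Set (Σ s, M.carrier s)) {n : ℕ} {τ : Fin n → L.Sorts} (φ : Formula L (Sum.elim σ τ))
    (h : ∀ ψ : Formula L (Sum.elim σ τ), T.Contradictory φ ψ →
      ∃ k, ¬ HasTree (M := M) φ ψ k Set.univ) :
    ∃ D : Set (PFormula M τ), (∀ d ∈ D, d.Over B) ∧ #D ≤ T.card ∧
      ∀ b : (j : Fin n) → M.carrier (τ j), (∀ j, ⟨τ j, b j⟩ ∈ B) →
        (N.Sat φ (N.join a (f.tuple b)) ↔ ∀ d ∈ D, d.Sat b) := by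
  classical
  obtain ⟨m, ⟨e⟩⟩ := Finite.exists_equiv_fin I
  choose d hdB hd using fun ψ hψ => exists_separating_formula hM hN f a B φ ψ (h ψ hψ)
  let P (c : T.Codes) : Prop := ∃ ψ, T.Contradictory φ ψ ∧ T.code e ψ = c
  let F (c : T.Codes) : PFormula M τ :=
    if hc : P c then d hc.choose hc.choose_spec.1 else ⟨0, Fin.elim0, .top, fun j => j.elim0⟩
  refine ⟨Set.range F, ?_, mk_range_le, fun b hb => ⟨?_, fun hall => ?_⟩⟩
  · rintro _ ⟨c, rfl⟩
    by_cases hc : P c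
    · simp only [F, dif_pos hc]
      exact hdB _ _
    · simp only [F, dif_neg hc]
      exact fun j => j.elim0
  · rintro hφ _ ⟨c, rfl⟩
    by_cases hc : P c
    · simp only [F, dif_pos hc]
      exact (hd _ _ b hb).1 hφ
    · simp only [F, dif_neg hc]
      trivial
  · by_contra hφ
    obtain ⟨ψ, hψ, hsat⟩ := hN.exists_contradictory φ _ hφ
    have hc : P (T.code e ψ) := ⟨ψ, hψ, rfl⟩
    have := hall _ ⟨T.code e ψ, rfl⟩
    simp only [F, dif_pos hc] at this
    refine (hd _ _ b hb).2 ?_ this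
    exact (Theory.sat_iff_of_code_eq hc.choose_spec.2 hN.1 _).2 hsat

theorem isDefinableOver_of_rank {M : Str L} (hM : T.IsPC M)
    (h : ∀ (I : Type u) [Finite I] (σ : I → L.Sorts) (n : ℕ) (τ : Fin n → L.Sorts)
      (φ ψ : Formula L (Sum.elim σ τ)), T.Contradictory φ ψ →
        ∃ k, ¬ HasTree (M := M) φ ψ k Set.univ)
    {B : Set (Σ s, M.carrier s)} {I : Type u} {σ : I → L.Sorts} {p : Set (PFormula M σ)}
    (hp : p ∈ T.typeSpace M B σ) : T.IsDefinableOver p B B := by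
  obtain ⟨N, hN, f, a, rfl⟩ := hp
  intro n τ φ
  -- Only finitely many of the variables in `I` occur in `φ`.
  obtain ⟨S, hS, φ', hφ'⟩ := φ.exists_support
  let σ₀ : {i // Sum.inl i ∈ S} → L.Sorts := fun i => σ i.1
  have : Finite {i // Sum.inl i ∈ S} :=
    (hS.preimage Sum.inl_injective.injOn : (Sum.inl ⁻¹' S).Finite).to_subtype
  let t : (z : S) → Term L (Sum.elim σ₀ τ) (Sum.elim σ τ z.1)
    | ⟨Sum.inl i, hi⟩ => Term.inl (Γ := σ₀) ⟨i, hi⟩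
    | ⟨Sum.inr j, _⟩ => Term.inr j
  obtain ⟨φ₀, hφ₀⟩ := (PosDef.sat φ').subst t
  obtain ⟨D, hDB, hD, hiff⟩ :=
    exists_definition hM hN f (σ := σ₀) (fun i => a i.1) B φ₀ (h _ _ _ _ φ₀)
  refine ⟨D, hDB, hD, fun b hb => Iff.trans ?_ (hiff b hb)⟩
  have key : N.Sat φ₀ (N.join (fun i : {i // Sum.inl i ∈ S} => a i.1) (f.tuple b)) ↔
      N.Sat φ (N.join a (f.tuple b)) := by
    refine (hφ₀ N _).trans (Iff.trans (iff_of_eq ?_) (hφ' N _))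
    refine congrArg (N.Sat φ') (funext ?_)
    rintro ⟨i | j, hz⟩ <;> rfl
  rw [key]
  exact ⟨fun h => h.2, fun h => ⟨hb, h⟩⟩

end Definability

/-! ### Counting definable types -/

section Counting

variable {T : Theory L} {M : Str L} {B : Set (Σ s, M.carrier s)}

/-- The set of finite tuples in `B` that satisfy the formula `d`. -/
def solutionSet (B : Set (Σ s, M.carrier s)) {n : ℕ} {τ : Fin n → L.Sorts} (d : PFormula M τ) :
    Set (Σ n, Fin n → B) :=
  {x | ∃ (b : (j : Fin n) → M.carrier (τ j)) (hb : ∀ j, ⟨τ j, b j⟩ ∈ B),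
    x = ⟨n, fun j => ⟨⟨τ j, b j⟩, hb j⟩⟩ ∧ d.Sat b}

/-- The solution sets in `B` of the formulas over `B`. -/
def solutionSets (B : Set (Σ s, M.carrier s)) : Set (Set (Σ n, Fin n → B)) :=
  {X | ∃ (n : ℕ) (τ : Fin n → L.Sorts) (d : PFormula M τ), d.Over B ∧ X = solutionSet B d}

/-- A formula over `B` is determined, modulo `T`, by the code of a formula without parameters and
a tuple of parameters. -/
theorem mk_solutionSets_le (hM : T.IsPC M) :
    #(solutionSets B) ≤ T.card * #(Σ n, Fin n → B) := by
  choose n τ d hd hX using fun X : solutionSets B => X.2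
  let F (X : solutionSets B) : T.Codes × Σ n, Fin n → B :=
    (T.code (Equiv.refl (Fin (n X))) (d X).φ,
      ⟨(d X).n, fun j => ⟨⟨(d X).τ j, (d X).b j⟩, hd X j⟩⟩)
  have key {n n' : ℕ} {τ : Fin n → L.Sorts} {τ' : Fin n' → L.Sorts} (d : PFormula M τ)
      (d' : PFormula M τ') (hd : d.Over B) (hd' : d'.Over B)
      (hc : T.code (Equiv.refl (Fin n)) d.φ = T.code (Equiv.refl (Fin n')) d'.φ)
      (hr : (⟨d.n, fun j => ⟨⟨d.τ j, d.b j⟩, hd j⟩⟩ : Σ n, Fin n → B) =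
        ⟨d'.n, fun j => ⟨⟨d'.τ j, d'.b j⟩, hd' j⟩⟩) : solutionSet B d = solutionSet B d' := by
    obtain ⟨k, ρ, φ, b⟩ := d
    obtain ⟨k', ρ', φ', b'⟩ := d'
    obtain rfl : k = k' := congrArg Sigma.fst hr
    have hr' := eq_of_heq (Sigma.mk.inj hr).2
    have hr'' (j) := congrArg Subtype.val (congrFun hr' j)
    obtain rfl : ρ = ρ' := funext fun j => congrArg Sigma.fst (hr'' j)
    obtain rfl : b = b' := funext fun j => eq_of_heq (Sigma.mk.inj (hr'' j)).2
    obtain rfl : n = n' := Nat.add_right_cancel (congrArg Sigma.fst hc)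
    obtain rfl : τ = τ' := funext fun j =>
      congrFun (Theory.sumElim_eq_of_code_eq hc) (Sum.inl j)
    ext x
    refine exists_congr fun c => exists_congr fun _ => and_congr Iff.rfl ?_
    exact Theory.sat_iff_of_code_eq hc hM.1 _
  refine (mk_le_of_injective (f := F) fun X Y h => Subtype.ext ?_).trans_eq (mk_prod _ _ |>.trans
    (by rw [lift_id, lift_id]; rfl))
  rw [hX X, hX Y]
  exact key _ _ (hd X) (hd Y) (congrArg Prod.fst h) (congrArg Prod.snd h)

/-- The tuples `b` in `B` such that `φ(x, b)` is in `p` for a formula `φ` with code `c`. -/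
def typeTrace {I : Type u} {σ : I → L.Sorts} {m : ℕ} (e : I ≃ Fin m) (p : Set (PFormula M σ))
    (B : Set (Σ s, M.carrier s)) (c : T.Codes) : Set (Σ n, Fin n → B) :=
  {x | ∃ φ : Formula L (Sum.elim σ fun j => (x.2 j).1.1), T.code e φ = c ∧
    (⟨x.1, _, φ, fun j => (x.2 j).1.2⟩ : PFormula M σ) ∈ p}

variable {I : Type u} {σ : I → L.Sorts} {m : ℕ} {e : I ≃ Fin m}

theorem mem_iff_of_code_eq {p : Set (PFormula M σ)} (hp : p ∈ T.typeSpace M B σ) {n : ℕ}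
    {τ : Fin n → L.Sorts} {φ φ' : Formula L (Sum.elim σ τ)} (h : T.code e φ = T.code e φ')
    (b : (j : Fin n) → M.carrier (τ j)) :
    (⟨n, τ, φ, b⟩ : PFormula M σ) ∈ p ↔ (⟨n, τ, φ', b⟩ : PFormula M σ) ∈ p := by
  obtain ⟨N, hN, f, a, rfl⟩ := hp
  exact and_congr Iff.rfl (Theory.sat_iff_of_code_eq h hN.1 _)

/-- A type is determined by its traces. -/
theorem type_subset_of_typeTrace {p q : Set (PFormula M σ)} (hp : p ∈ T.typeSpace M B σ)
    (hq : q ∈ T.typeSpace M B σ)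
    (h : ∀ c : T.Codes, typeTrace e p B c = typeTrace e q B c) : p ⊆ q := by
  rintro ⟨n, τ, φ, b⟩ hφ
  have hb : ∀ j, (⟨τ j, b j⟩ : Σ s, M.carrier s) ∈ B := by
    obtain ⟨N, hN, f, a, rfl⟩ := hp
    exact hφ.1
  have hx : (⟨n, fun j => ⟨⟨τ j, b j⟩, hb j⟩⟩ : Σ n, Fin n → B) ∈
      typeTrace e p B (T.code e φ) := ⟨φ, rfl, hφ⟩
  rw [h] at hx
  obtain ⟨φ', hc, hφ'⟩ := hx
  exact (mem_iff_of_code_eq hq hc b).1 hφ'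

/-- The traces of a definable type are intersections of at most `|T|` solution sets. -/
theorem typeTrace_eq_iInter {p : Set (PFormula M σ)} (hp : p ∈ T.typeSpace M B σ)
    (hdef : T.IsDefinableOver p B B) (c : T.Codes) :
    ∃ F : T.Codes → solutionSets B, typeTrace e p B c = ⋂ i, (F i).1 := by
  by_cases hc : ∃ (n : ℕ) (τ : Fin n → L.Sorts) (φ : Formula L (Sum.elim σ τ)), T.code e φ = c
  · obtain ⟨n, τ, φ, rfl⟩ := hc
    obtain ⟨D, hDB, hne, hD, hiff⟩ : ∃ D : Set (PFormula M τ), (∀ d ∈ D, d.Over B) ∧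
        D.Nonempty ∧ #D ≤ T.card ∧ ∀ b : (j : Fin n) → M.carrier (τ j),
          (∀ j, ⟨τ j, b j⟩ ∈ B) → ((⟨n, τ, φ, b⟩ : PFormula M σ) ∈ p ↔ ∀ d ∈ D, d.Sat b) := by
      obtain ⟨D, hDB, hD, hiff⟩ := hdef n τ φ
      rcases D.eq_empty_or_nonempty with rfl | hne
      · refine ⟨{⟨0, Fin.elim0, .top, fun j => j.elim0⟩}, ?_, Set.singleton_nonempty _, ?_, ?_⟩
        · rintro d rfl
          exact fun j => j.elim0
        · exact mk_le_of_injective (f := fun _ => T.code e φ) (Function.injective_of_subsingleton _)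
        · intro b hb
          rw [hiff b hb]
          refine iff_of_true (by simp) ?_
          rintro d rfl
          trivial
      · exact ⟨D, hDB, hne, hD, hiff⟩
    have := hne.to_subtype
    obtain ⟨j⟩ := hD
    let F (i : T.Codes) : D := Function.invFun j i
    have hF : Function.Surjective F := Function.invFun_surjective j.injective
    refine ⟨fun i => ⟨solutionSet B (F i).1, n, τ, _, hDB _ (F i).2, rfl⟩, ?_⟩
    ext ⟨n', xs⟩
    rw [Set.mem_iInter]
    constructor
    · rintro ⟨φ', hcode, hφ'⟩ i
      obtain rfl : n' = n := Theory.length_eq_of_code_eq hcode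
      obtain rfl : (fun j => (xs j).1.1) = τ := Theory.sorts_eq_of_code_eq hcode
      rw [mem_iff_of_code_eq hp hcode, hiff _ fun j => (xs j).2] at hφ'
      exact ⟨fun j => (xs j).1.2, fun j => (xs j).2, rfl, hφ' _ (F i).2⟩
    · intro h
      obtain ⟨b, hb, hx, -⟩ := h (T.code e φ)
      rw [hx] at h ⊢
      refine ⟨φ, rfl, (hiff b hb).2 fun d hd => ?_⟩
      obtain ⟨i, hi⟩ := hF ⟨d, hd⟩
      obtain ⟨b', hb', hx', hs⟩ := h i
      have hx'' := eq_of_heq (Sigma.mk.inj hx').2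
      obtain rfl : b = b' := funext fun j =>
        eq_of_heq (Sigma.mk.inj (congrArg Subtype.val (congrFun hx'' j))).2
      rwa [hi] at hs
  · refine ⟨fun _ => ⟨solutionSet B (τ := Fin.elim0) ⟨0, Fin.elim0, .bot, fun j => j.elim0⟩,
      0, _, _, fun j => j.elim0, rfl⟩, ?_⟩
    ext x
    rw [Set.mem_iInter]
    constructor
    · rintro ⟨φ, hφ, -⟩
      exact absurd ⟨_, _, φ, hφ⟩ hc
    · intro h
      obtain ⟨b, hb, -, hs⟩ := h c
      exact hs.elim

theorem mk_tuples_le {lam : Cardinal.{u}} (hlam : ℵ₀ ≤ lam) {A : Type u} (hA : #A ≤ lam) :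
    #(Σ n, Fin n → A) ≤ lam := by
  rw [← mk_congr (List.equivSigmaTuple (α := A))]
  exact (mk_list_le_max A).trans (max_le hlam hA)

theorem mk_typeSpace_le (hM : T.IsPC M) {lam : Cardinal.{u}} (hlam : ℵ₀ ≤ lam)
    (hpow : lam ^ T.card = lam) (hB : #B ≤ lam) [Finite I]
    (hdef : ∀ p ∈ T.typeSpace M B σ, T.IsDefinableOver p B B) :
    #(T.typeSpace M B σ) ≤ lam := by
  obtain ⟨m, ⟨e⟩⟩ := Finite.exists_equiv_fin I
  have hcard : T.card ≤ lam := by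
    rw [← hpow]
    exact (cantor _).le.trans (power_le_power_right ((natCast_lt_aleph0 (n := 2)).le.trans hlam))
  have hsol : #(solutionSets B) ≤ lam := (mk_solutionSets_le hM).trans <|
    (mul_le_mul' hcard (mk_tuples_le hlam hB)).trans_eq (mul_eq_self hlam)
  choose F hF using fun p : T.typeSpace M B σ => typeTrace_eq_iInter (e := e) p.2 (hdef p.1 p.2)
  have hinj : Function.Injective F := fun p q h => by
    have htr (c : T.Codes) : typeTrace e p.1 B c = typeTrace e q.1 B c := by rw [hF, hF, h]
    exact Subtype.ext ((type_subset_of_typeTrace p.2 q.2 htr).antisymm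
      (type_subset_of_typeTrace q.2 p.2 fun c => (htr c).symm))
  calc #(T.typeSpace M B σ) ≤ #(T.Codes → T.Codes → solutionSets B) := mk_le_of_injective hinj
    _ = (#(solutionSets B) ^ T.card) ^ T.card := by simp only [← power_def]; rfl
    _ ≤ (lam ^ T.card) ^ T.card := power_le_power_right (power_le_power_right hsol)
    _ = lam := by rw [hpow, hpow]

end Counting

/-! ### Instability from trees -/

section Instability

variable {T : Theory L} {M : Str L}

variable {I : Type u} {σ : I → L.Sorts} {n : ℕ} {τ : Fin n → L.Sorts}
  {φ ψ : Formula L (Sum.elim σ τ)}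

/-- The nodes and branches of a tree of height `k`. The node at level `i` below the branch `η`
is recorded as a function of `η`, which depends only on the part of `η` before `i`. -/
theorem HasTree.exists_branches {k : ℕ} {X : Set ((i : I) → M.carrier (σ i))}
    (h : HasTree φ ψ k X) :
    ∃ (b : Fin k → (Fin k → Bool) → (j : Fin n) → M.carrier (τ j))
      (c : (Fin k → Bool) → (i : I) → M.carrier (σ i)), (∀ η, c η ∈ X) ∧
      (∀ η η' i, (∀ j < i, η j = η' j) → b i η = b i η') ∧
      ∀ η i, M.Sat (bif η i then φ else ψ) (M.join (c η) (b i η)) := by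
  induction k generalizing X with
  | zero =>
    obtain ⟨a, ha⟩ := h
    exact ⟨fun i => i.elim0, fun _ => a, fun _ => ha, fun _ _ i => i.elim0, fun _ i => i.elim0⟩
  | succ k ih =>
    obtain ⟨b₀, h₁, h₂⟩ := h
    obtain ⟨b₁, c₁, hX₁, hb₁, hs₁⟩ := ih h₁
    obtain ⟨b₂, c₂, hX₂, hb₂, hs₂⟩ := ih h₂
    refine ⟨fun i η => Fin.cases b₀
        (fun i => (bif η 0 then b₁ else b₂) i (Fin.tail η)) i,
      fun η => (bif η 0 then c₁ else c₂) (Fin.tail η), fun η => ?_, fun η η' i => ?_,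
      fun η i => ?_⟩
    · beta_reduce
      cases η 0
      · exact (hX₂ _).1
      · exact (hX₁ _).1
    · refine Fin.cases (fun _ => rfl) (fun i hi => ?_) i
      simp only [Fin.cases_succ, hi 0 (Fin.succ_pos i)]
      have ht : ∀ j < i, Fin.tail η j = Fin.tail η' j := fun j hj =>
        hi j.succ (Fin.succ_lt_succ_iff.2 hj)
      cases η' 0
      · exact hb₂ _ _ i ht
      · exact hb₁ _ _ i ht
    · refine Fin.cases ?_ (fun i => ?_) i
      · simp only [Fin.cases_zero]
        cases η 0
        · exact (hX₂ _).2
        · exact (hX₁ _).2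
      · simp only [Fin.cases_succ]
        cases η 0
        · exact hs₂ (Fin.tail η) i
        · exact hs₁ (Fin.tail η) i

/-- By compactness there are trees with any linearly ordered set `A` of levels. -/
theorem exists_tree [Finite I] (hM : T.IsModel M)
    (h : ∀ k, HasTree (M := M) φ ψ k Set.univ) (A : Type u) [LinearOrder A] :
    ∃ N : Str L, T.IsModel N ∧
      ∃ (b : (α : A) → (Set.Iio α → Bool) → (j : Fin n) → N.carrier (τ j))
        (c : (A → Bool) → (i : I) → N.carrier (σ i)),
        ∀ η α, N.Sat (bif η α then φ else ψ) (N.join (c η) (b α fun β => η β)) := by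
  classical
  let V : Type u := (Σ α : A, Set.Iio α → Bool) × Fin n ⊕ (A → Bool) × I
  let Γ : V → L.Sorts := Sum.elim (fun p => τ p.2) (fun p => σ p.2)
  let g (p : (A → Bool) × A) : I ⊕ Fin n → V :=
    Sum.elim (fun i => Sum.inr (p.1, i)) (fun j => Sum.inl (⟨p.2, fun β => p.1 β⟩, j))
  let t (p : (A → Bool) × A) : (z : I ⊕ Fin n) → Term L (fun z => Γ (g p z)) (Sum.elim σ τ z)
    | Sum.inl i => .var (Γ := fun z => Γ (g p z)) (Sum.inl i)
    | Sum.inr j => .var (Γ := fun z => Γ (g p z)) (Sum.inr j)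
  choose χ hχ using fun p : (A → Bool) × A =>
    (PosDef.sat (bif p.1 p.2 then φ else ψ)).subst (t p)
  have hsat (p : (A → Bool) × A) (N : Str L) (d : (x : V) → N.carrier (Γ x)) :
      N.Sat (χ p) (fun z => d (g p z)) ↔ N.Sat (bif p.1 p.2 then φ else ψ)
        (N.join (fun i => d (Sum.inr (p.1, i)))
          (fun j => d (Sum.inl (⟨p.2, fun β => p.1 β⟩, j)))) := by
    refine (hχ p N _).trans (iff_of_eq (congrArg _ (funext fun z => ?_)))
    rcases z with i | j <;> rfl
  obtain ⟨N, hN, d, hd⟩ := compactness T Γ g χ (by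
    intro F G
    -- A tree of finite height suffices: only the levels that occur in `F` matter.
    let s : Finset A := F.image Prod.snd
    obtain ⟨b, c, -, hb, hs⟩ := (h (s.card + 1)).exists_branches
    let ι := s.orderIsoOfFin rfl
    let level (α : A) : Fin (s.card + 1) :=
      if hα : α ∈ s then (ι.symm ⟨α, hα⟩).castSucc else 0
    let enc (η : A → Bool) : Fin (s.card + 1) → Bool :=
      Fin.snoc (α := fun _ => Bool) (fun i => η (ι i)) false
    let ext (α : A) (ν : Set.Iio α → Bool) (β : A) : Bool :=
      if hβ : β < α then ν ⟨β, hβ⟩ else false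
    let d (x : V) : M.carrier (Γ x) := match x with
      | Sum.inl (⟨α, ν⟩, j) => b (level α) (enc (ext α ν)) j
      | Sum.inr (η, i) => c (enc η) i
    refine ⟨M, hM, fun x _ => d x, fun p hp _ => (hsat p M d).2 ?_⟩
    have hmem : p.2 ∈ s := Finset.mem_image_of_mem _ hp
    have hlevel : level p.2 = (ι.symm ⟨p.2, hmem⟩).castSucc := dif_pos hmem
    have henc (η : A → Bool) (i : Fin s.card) : enc η i.castSucc = η (ι i) :=
      Fin.snoc_castSucc (α := fun _ => Bool) _ _ i
    have hbranch := hs (enc p.1) (level p.2)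
    rw [hlevel, henc, OrderIso.apply_symm_apply, ← hlevel] at hbranch
    have hnode : b (level p.2) (enc (ext p.2 fun β => p.1 β)) = b (level p.2) (enc p.1) := by
      refine hb _ _ _ fun j hj => ?_
      rw [hlevel] at hj
      obtain ⟨j, rfl⟩ := Fin.exists_castSucc_eq.2 (hj.trans_le (Fin.le_last _)).ne
      rw [henc, henc]
      have : ((ι j : s) : A) < p.2 := by
        have := ι.lt_symm_apply.1 (Fin.castSucc_lt_castSucc_iff.1 hj)
        exact this
      exact dif_pos this
    refine (iff_of_eq (congrArg (M.Sat _) ?_)).1 hbranch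
    rw [← hnode])
  refine ⟨N, hN, fun α ν j => d (Sum.inl (⟨α, ν⟩, j)), fun η i => d (Sum.inr (η, i)),
    fun η α => (hsat (η, α) N d).1 (hd (η, α))⟩

/-- For the least `μ` with `λ < 2 ^ μ`, a binary tree of height `μ` has at most `λ` nodes but more
than `λ` branches, and different branches realise different types over the nodes. -/
theorem not_isLambdaStable [Finite I] (hM : T.IsModel M) (hcon : T.Contradictory φ ψ)
    (h : ∀ k, HasTree (M := M) φ ψ k Set.univ) (lam : Cardinal.{u}) : ¬ T.IsLambdaStable lam := by
  rintro ⟨hlam, hstable⟩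
  have hbool (A : Type u) : #(A → Bool) = 2 ^ #A := by
    rw [mk_arrow, mk_bool, lift_two, lift_uzero]
  have hex : ∃ μ : Cardinal.{u}, lam < 2 ^ μ := ⟨lam, cantor lam⟩
  let μ : Cardinal.{u} := sInf {μ | lam < 2 ^ μ}
  have hμ : lam < 2 ^ μ := csInf_mem hex
  have hmin {κ : Cardinal.{u}} (hκ : κ < μ) : 2 ^ κ ≤ lam := 
    not_lt.1 fun h => (csInf_le' (s := {μ | lam < 2 ^ μ}) h).not_gt hκ
  have hμlam : μ ≤ lam := csInf_le' (cantor lam)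
  obtain ⟨K, hK, b, c, hbc⟩ := exists_tree hM h μ.ord.ToType
  obtain ⟨N, hN, ⟨f⟩⟩ := T.exists_isPC hK
  have hsat (η : μ.ord.ToType → Bool) (α : μ.ord.ToType) :
      N.Sat (bif η α then φ else ψ) (N.join (f.tuple (c η)) (f.tuple (b α fun β => η β))) := by
    rw [← f.tuple_join]
    exact f.sat_tuple _ (hbc η α)
  let node (p : (Σ α : μ.ord.ToType, Set.Iio α → Bool) × ULift.{u} (Fin n)) :
      Σ s, N.carrier s := ⟨τ p.2.down, f.tuple (b p.1.1 p.1.2) p.2.down⟩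
  have hB : #(Set.range node) ≤ lam := by
    have hnodes : #(Σ α : μ.ord.ToType, Set.Iio α → Bool) ≤ lam := by
      rw [mk_sigma]
      refine (sum_le_sum _ (fun _ => lam) fun α => ?_).trans ?_
      · rw [hbool]
        exact hmin ((mk_Iio_lt α (by simp)).trans_eq (mk_ord_toType μ))
      · rw [sum_const', mk_ord_toType]
        exact (mul_le_mul_left hμlam lam).trans_eq (mul_eq_self hlam)
    refine mk_range_le.trans ?_
    rw [mk_prod, lift_id, lift_id]
    refine (mul_le_mul' hnodes ?_).trans_eq (mul_eq_self hlam)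
    exact (lt_aleph0_of_finite _).le.trans hlam
  let p (η : μ.ord.ToType → Bool) : T.typeSpace N (Set.range node) σ :=
    ⟨_, N, hN, Hom.id N, f.tuple (c η), rfl⟩
  have hp (η : μ.ord.ToType → Bool) (α : μ.ord.ToType) :
      (⟨n, τ, bif η α then φ else ψ, f.tuple (b α fun β => η β)⟩ : PFormula N σ) ∈ (p η).1 :=
    ⟨fun j => ⟨(⟨α, fun β => η β⟩, ⟨j⟩), rfl⟩, hsat η α⟩
  have hinj : Function.Injective p := by
    intro η η' heq
    by_contra hne
    obtain ⟨α, hα, hlt⟩ := WellFounded.has_min (wellFounded_lt (α := μ.ord.ToType))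
      {α | η α ≠ η' α} (Function.ne_iff.1 hne)
    -- `α` is the level where the branches split.
    have hnode : (fun β : Set.Iio α => η β) = fun β : Set.Iio α => η' β :=
      funext fun β => not_not.1 fun hβ => hlt β hβ β.2
    have h₁ := hp η α
    rw [heq, hnode] at h₁
    have h₂ := hp η' α
    have hα' : η α ≠ η' α := hα
    refine hcon N hN.1 (N.join (f.tuple (c η')) (f.tuple (b α fun β => η' β))) ?_
    replace h₁ := h₁.2
    replace h₂ := h₂.2
    generalize η α = x at h₁ hα'
    generalize η' α = y at h₂ hα'
    cases x <;> cases y <;> first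
      | exact absurd rfl hα'
      | exact ⟨h₁, h₂⟩
      | exact ⟨h₂, h₁⟩
  have hle := (mk_le_of_injective hinj).trans (hstable N hN _ hB I σ)
  rw [hbool, mk_ord_toType] at hle
  exact hle.not_gt hμ

end Instability

end PositiveLogic

theorem mainTheorem8 (L : PositiveLogic.Signature.{u}) (T : PositiveLogic.Theory L) :
    List.TFAE [
      T.IsStable,
      ∀ M : PositiveLogic.Str L, T.IsPC M →
        ∀ (I : Type u) [Finite I] (σ : I → L.Sorts) (n : ℕ) (τ : Fin n → L.Sorts)
          (φ ψ : PositiveLogic.Formula L (Sum.elim σ τ)), T.Contradictory φ ψ →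
          T.rank φ ψ M (PositiveLogic.selfEq M σ) <
            ((Ordinal.omega0 : WithTop Ordinal.{u}) : WithBot (WithTop Ordinal.{u})),
      ∀ M : PositiveLogic.Str L, T.IsPC M → ∀ (B : Set (Σ s, M.carrier s))
        (I : Type u) (σ : I → L.Sorts), ∀ p ∈ T.typeSpace M B σ, T.IsDefinableOver p B B,
      ∀ lam : Cardinal.{u}, ℵ₀ ≤ lam → lam ^ T.card = lam → T.IsLambdaStable lam] := by
  tfae_have 1 → 2 := by
    rintro ⟨lam, hlam⟩ M hM I _ σ n τ φ ψ hcon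
    rw [PositiveLogic.Theory.rank_selfEq_lt_omega0_iff hM]
    by_contra! h
    exact PositiveLogic.not_isLambdaStable hM.1 hcon h lam hlam
  tfae_have 2 → 3 := by
    intro h M hM B I σ p hp
    refine PositiveLogic.isDefinableOver_of_rank hM (fun I _ σ n τ φ ψ hcon => ?_) hp
    exact (PositiveLogic.Theory.rank_selfEq_lt_omega0_iff hM).1 (h M hM I σ n τ φ ψ hcon)
  tfae_have 3 → 4 := fun h lam hlam hpow => ⟨hlam, fun M hM B hB I _ σ =>
    PositiveLogic.mk_typeSpace_le hM hlam hpow hB (h M hM B I σ)⟩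
  tfae_have 4 → 1 := by
    intro h
    have hinf : ℵ₀ ≤ max T.card ℵ₀ := le_max_right _ _
    refine ⟨2 ^ max T.card ℵ₀, h _ (hinf.trans (cantor _).le) ?_⟩
    rw [← power_mul, mul_comm]
    -- `|T|` is nonzero, as there are formulas without free variables.
    have hne : T.card ≠ 0 := mk_ne_zero_iff.2 ⟨⟨0, Fin.elim0, Quotient.mk _ .top⟩⟩
    rw [mul_eq_right hinf (le_max_left _ _) hne]
  tfae_finish
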